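/- **Proposition ($SE(3)$-bi-equivariance of BITR).** $SE(3)$ is the group of rigid motions $g=(r,t)$, $gx=rx+t$, $r\in SO(3)$, $t\in\mathbb R^3$. For point clouds $X=(x_u)_{u=1}^M$, $Y=(y_v)_{v=1}^N$ in $\mathbb R^3$ ($M,N\ge 1$) write $gX=(gx_u)_u$. *Features.* A degree-$p$ feature is a vector in $\mathbb R^{2p+1}$, a degree-$(p,q)$ feature a vector in $\mathbb R^{2p+1}\otimes\mathbb R^{2q+1}$; components are indexed by the orders $m=-p,\dots,p$ of the real spherical harmonics $Y_p$. A feature field attaches to each point finitely many channels $F^{i}$ of finitely many degrees $i$. *Kernels.* Let $Q^{o,i}_{J}$ denote the Clebsch–Gordan coefficients $\langle i\,m_1\,o\,m_3\mid J\,m_5\rangle$ in the basis of real spherical harmonics. An $SE(3)$-kernel is $$\mathcal W^{o,i}(x)_{m_3,m_1}=\sum_{J=|o-i|}^{o+i}\varphi_J(\|x\|)\sum_{m_5}\langle i\,m_1\,o\,m_3\mid J\,m_5\rangle\,Y_J^{m_5}\!\left(\tfrac{x}{\|x\|}\right),$$ and, for $o=(o_1,o_2)$, $i=(i_1,i_2)$,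 $z=z^1\oplus z^2\in\mathbb R^6$, an $SE(3)\times SE(3)$-kernel is $$\mathcal W^{o,i}(z)_{(m_3,m_4),(m_1,m_2)}=\sum_{J_1=|o_1-i_1|}^{o_1+i_1}\ \sum_{J_2=|o_2-i_2|}^{o_2+i_2}\varphi_{J_1,J_2}(\|z^1\|,\|z^2\|)\sum_{m_5,m_6}\langle i_1m_1o_1m_3|J_1m_5\rangle\langle i_2m_2o_2m_4|J_2m_6\rangle\,Y_{J_1}^{m_5}\!\left(\tfrac{z^1}{\|z^1\|}\right)Y_{J_2}^{m_6}\!\left(\tfrac{z^2}{\|z^2\|}\right),$$ with arbitrary radial functions $\varphi$. (At a zero vector, $Y_J(0/\|0\|)$ is read as $0$ for $J\ge1$; $Y_0$ is constant.) *Layers.* A transformer layer on points $z_u$ is $$f^{o}_{\rm out}(z_u)=W^{o}F^{o}_{\rm in}(z_u)+\sum_{v\in KNN(u)\setminus\{u\}}\alpha_{uv}\sum_{i}\mathcal W_V^{o,i}(z_v-z_u)f^{i}_{\rm in}(z_v),\qquad \alpha_{uv}=\frac{\exp\langle \mathbf Q_u,\mathbf K_{uv}\rangle}{\sum_{v'\in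 KNN(u)\setminus\{u\}}\exp\langle \mathbf Q_u,\mathbf K_{uv'}\rangle},$$ $\mathbf Q_u=\bigoplus_{o}W_Q^{o}F_{\rm in}^{o}(z_u)$, $\mathbf K_{uv}=\bigoplus_{o}\sum_{i}\mathcal W_K^{o,i}(z_v-z_u)f_{\rm in}^{i}(z_v)$, where $KNN(u)$ are the $k$ nearest points (ties broken by index), $W^o,W_Q^o$ are arbitrary matrices acting on channels, and every pair of an output channel and an input channel has its own kernel. An Elu layer is, channel by channel, $$F^{i}\mapsto F_\mu\ \text{ if }\langle F_\mu,F_\nu\rangle\ge0,\qquad F^{i}\mapsto F_\mu-\Big\langle F_\mu,\tfrac{F_\nu}{\|F_\nu\|}\Big\rangle\tfrac{F_\nu}{\|F_\nu\|}\ \text{ otherwise},\qquad F_\mu=W_\mu^{i}F^{i},\ F_\nu=W_\nu^{i}F^{i}.$$ An $SE(3)$-transformer (points in $\mathbb R^3$, degrees $p$), respectively an $SE(3)\times SE(3)$-transformer (points in $\mathbb R^6$, degrees $(p,q)$), is a finite composition of such layers. *$\Phi_S$.* A shared $SE(3)$-transformer, started from constant degree-$0$ features, is applied to $X$ and to $Y$;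 then to the degree-$0$ features at each point of $X$ the average over $Y$ of the degree-$0$ features is appended, and vice versa, and the remaining layers are applied to each of $X$ and $Y$. The $L$ degree-$0$ output channels form $F_X\in\mathbb R^{L\times M}$, $F_Y\in\mathbb R^{L\times N}$. With the row-wise softmax, the key points are $\tilde X=\mathrm{SoftMax}(F_X)X$, $\tilde Y=\mathrm{SoftMax}(F_Y)Y$, and $\Phi_S(X,Y)$ is the feature field that an $SE(3)\times SE(3)$-transformer, started from constant degree-$(0,0)$ features, produces on $Z=(\tilde x_u\oplus\tilde y_u)_{u=1}^L\subset\mathbb R^6$. *$\Phi_P$.* For a feature field $f$ on $Z$ with a distinguished channel of each of the degrees $(1,1)$, $(1,0)$, $(0,1)$, let $\tilde r,t_X,t_Y$ be the averages of $f_u^{1,1},f_u^{1,0},f_u^{0,1}$ over $u$, in Cartesian coordinates, and let $\hat r=\mathrm{unvec}(\tilde r)\in\mathbb R^{3\times3}$ be $\tilde r$ as a matrix whose columns belong to the first tensor factor. Then $\Phi_P(f)=(r,t)$ with $$r=\mathrm{SVD}(\hat r),\qquad t=(\boldsymbol m(\tilde Y)+t_Y)-r(\boldsymbol m(\tilde X)+t_X),$$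 where $\boldsymbol m$ is the mean and $\mathrm{SVD}(A)=U\,\mathrm{diag}(1,1,\mathrm{sign}\det(UV^{T}))\,V^{T}$ for a singular value decomposition $A=U\,\mathrm{diag}(\sigma_1,\sigma_2,\sigma_3)V^{T}$, $U,V\in O(3)$, $\sigma_1\ge\sigma_2\ge\sigma_3\ge0$. *Claim.* For every choice of architecture and parameters and all $X,Y$ such that the smallest singular value of $\hat r=\hat r(\Phi_S(X,Y))$ is distinct, i.e. $\sigma_1\ge\sigma_2>\sigma_3\ge0$, $$\Phi_P\circ\Phi_S(g_1X,g_2Y)=g_2\,\bigl(\Phi_P\circ\Phi_S(X,Y)\bigr)\,g_1^{-1}\qquad\text{for all } g_1,g_2\in SE(3).$$ -/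

import Mathlib

namespace BITR

open Matrix

noncomputable section

/-! ### Rigid motions of three-space -/

/-- Coordinate vectors of `ℝ³`. -/
abbrev Vec3 : Type := Fin 3 → ℝ

/-- The rotation group `SO(3)`. -/
abbrev SO3 : Type := Matrix.specialOrthogonalGroup (Fin 3) ℝ

/-- A rigid motion `g = (r, t)`, acting by `x ↦ r x + t`. -/
@[ext]
structure SE3 : Type where
  rot : SO3
  trans : Vec3

namespace SE3

/-- The action `g x = r x + t` of a rigid motion on a point. -/
def act (g : SE3) (x : Vec3) : Vec3 := g.rot.1 *ᵥ x + g.trans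

instance : Mul SE3 := ⟨fun g h => ⟨g.rot * h.rot, g.rot.1 *ᵥ h.trans + g.trans⟩⟩
instance : One SE3 := ⟨⟨1, 0⟩⟩
instance : Inv SE3 := ⟨fun g => ⟨g.rot⁻¹, -((g.rot⁻¹).1 *ᵥ g.trans)⟩⟩

theorem mul_def (g h : SE3) : g * h = ⟨g.rot * h.rot, g.rot.1 *ᵥ h.trans + g.trans⟩ := rfl
theorem one_def : (1 : SE3) = ⟨1, 0⟩ := rfl
theorem inv_def (g : SE3) : g⁻¹ = ⟨g.rot⁻¹, -((g.rot⁻¹).1 *ᵥ g.trans)⟩ := rfl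

/-- Rigid motions form a group under composition. -/
instance : Group SE3 :=
  Group.ofLeftAxioms
    (by
      intro a b c
      simp only [mul_def, SE3.mk.injEq]
      refine ⟨mul_assoc _ _ _, ?_⟩
      simp [Matrix.mulVec_add, Matrix.mulVec_mulVec, add_assoc])
    (by intro a; ext <;> simp [mul_def, one_def])
    (by intro a; ext <;> simp [mul_def, one_def, inv_def])

theorem mul_act (g h : SE3) (x : Vec3) : (g * h).act x = g.act (h.act x) := by
  simp [act, mul_def, Matrix.mulVec_add, Matrix.mulVec_mulVec, add_assoc]

end SE3

/-- A point cloud of `M` points in `ℝ³`. -/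
abbrev Cloud (M : ℕ) : Type := Fin M → Vec3

/-- The transformed point cloud `g X`. -/
def SE3.actCloud {M : ℕ} (g : SE3) (X : Cloud M) : Cloud M := fun u => g.act (X u)

/-- The Euclidean norm of a coordinate vector. -/
def len (x : Vec3) : ℝ := ‖WithLp.toLp 2 x‖

/-- The average over a finite family of vectors. -/
def pool {n : ℕ} {V : Type} [AddCommGroup V] [Module ℝ V] (x : Fin n → V) : V :=
  (n : ℝ)⁻¹ • ∑ u, x u

/-! ### Singular value decomposition and the projection to `SO(3)` -/

/-- `A = U diag(σ) Vᵀ` is a singular value decomposition: `U, V` are orthogonal and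
`σ₁ ≥ σ₂ ≥ σ₃ ≥ 0`. -/
structure IsSVD (A U V : Matrix (Fin 3) (Fin 3) ℝ) (σ : Fin 3 → ℝ) : Prop where
  left_mem : U ∈ Matrix.orthogonalGroup (Fin 3) ℝ
  right_mem : V ∈ Matrix.orthogonalGroup (Fin 3) ℝ
  antitone : Antitone σ
  nonneg : ∀ i, 0 ≤ σ i
  eq : A = U * Matrix.diagonal σ * Vᵀ

/-- The smallest singular value is distinct: `σ₁ ≥ σ₂ > σ₃ ≥ 0`. -/
def SmallestSingularValueDistinct (A : Matrix (Fin 3) (Fin 3) ℝ) : Prop :=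
  ∃ U V σ, IsSVD A U V σ ∧ σ 2 < σ 1

/-- The matrix `U diag(1, 1, sign (det (U Vᵀ))) Vᵀ`. -/
def signedProduct (U V : Matrix (Fin 3) (Fin 3) ℝ) : Matrix (Fin 3) (Fin 3) ℝ :=
  U * Matrix.diagonal ![1, 1, Real.sign (U * Vᵀ).det] * Vᵀ

theorem basisMatrix_mem (b : OrthonormalBasis (Fin 3) ℝ (EuclideanSpace ℝ (Fin 3))) :
    (Matrix.of fun a i => b i a) ∈ Matrix.orthogonalGroup (Fin 3) ℝ := by
  rw [Matrix.mem_orthogonalGroup_iff']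
  ext i j
  have h := orthonormal_iff_ite.1 b.orthonormal i j
  rw [Matrix.one_apply, ← h]
  simp [Matrix.mul_apply, PiLp.inner_apply, mul_comm]

theorem exists_isSVD (A : Matrix (Fin 3) (Fin 3) ℝ) : ∃ U V σ, IsSVD A U V σ := by
  have hn : Module.finrank ℝ (EuclideanSpace ℝ (Fin 3)) = 3 := by simp
  let T : EuclideanSpace ℝ (Fin 3) →ₗ[ℝ] EuclideanSpace ℝ (Fin 3) := Matrix.toEuclideanLin A
  let b := T.isSymmetric_adjoint_comp_self.eigenvectorBasis hn
  let σ : Fin 3 → ℝ := fun i => T.singularValues i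
  have hinner (i j : Fin 3) : inner ℝ (T (b i)) (T (b j)) = if i = j then σ i ^ 2 else 0 := by
    have h1 : (LinearMap.adjoint T ∘ₗ T) (b i) = (σ i ^ 2) • b i := by
      rw [T.sq_singularValues_fin hn i]
      exact T.isSymmetric_adjoint_comp_self.apply_eigenvectorBasis hn i
    rw [← LinearMap.adjoint_inner_left]
    have h2 : (LinearMap.adjoint T) (T (b i)) = (σ i ^ 2) • b i := h1
    rw [h2, real_inner_smul_left, orthonormal_iff_ite.1 b.orthonormal i j]
    simp
  obtain ⟨c, hc⟩ := Orthonormal.exists_orthonormalBasis_extension_of_card_eq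
    (𝕜 := ℝ) (E := EuclideanSpace ℝ (Fin 3)) (ι := Fin 3) (by simp)
    (v := fun i => (σ i)⁻¹ • T (b i)) (s := {i | σ i ≠ 0}) (by
      rw [orthonormal_iff_ite]
      rintro ⟨i, hi⟩ ⟨j, hj⟩
      have hi' : σ i ≠ 0 := hi
      simp only [Set.domRestrict_apply, real_inner_smul_left, real_inner_smul_right, hinner,
        Subtype.mk.injEq]
      split_ifs with h
      · subst h; field_simp
      · simp)
  have hT (i : Fin 3) : T (b i) = σ i • c i := by
    by_cases hi : σ i = 0
    · have := hinner i i
      rw [if_pos rfl, hi] at this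
      simp only [ne_eq, OfNat.ofNat_ne_zero, not_false_eq_true, zero_pow,
        inner_self_eq_zero] at this
      rw [this, hi, zero_smul]
    · rw [hc i hi, smul_smul, mul_inv_cancel₀ hi, one_smul]
  have hVmem := basisMatrix_mem b
  refine ⟨Matrix.of fun a i => c i a, Matrix.of fun a i => b i a, σ, basisMatrix_mem c, hVmem,
    fun i j h => T.singularValues_antitone h, fun i => T.singularValues_nonneg i, ?_⟩
  have hAV : A * (Matrix.of fun a i => b i a) =
      (Matrix.of fun a i => c i a) * Matrix.diagonal σ := by
    ext a j
    have h := congrArg (fun x : EuclideanSpace ℝ (Fin 3) => x a) (hT j)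
    rw [Matrix.mul_diagonal]
    simp only [PiLp.smul_apply, smul_eq_mul] at h
    rw [Matrix.of_apply, mul_comm, ← h]
    rfl
  rw [← hAV, Matrix.mul_assoc, (Matrix.mem_orthogonalGroup_iff (Fin 3) ℝ).1 hVmem, Matrix.mul_one]

theorem signedProduct_mem {U V : Matrix (Fin 3) (Fin 3) ℝ}
    (hU : U ∈ Matrix.orthogonalGroup (Fin 3) ℝ) (hV : V ∈ Matrix.orthogonalGroup (Fin 3) ℝ) :
    signedProduct U V ∈ Matrix.specialOrthogonalGroup (Fin 3) ℝ := by
  have hV' : Vᵀ ∈ Matrix.orthogonalGroup (Fin 3) ℝ := by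
    rw [Matrix.mem_orthogonalGroup_iff, Matrix.transpose_transpose]
    exact (Matrix.mem_orthogonalGroup_iff' (Fin 3) ℝ).1 hV
  have hdet : (U * Vᵀ).det * (U * Vᵀ).det = 1 := by
    have h := (Matrix.mem_orthogonalGroup_iff (Fin 3) ℝ).1 (mul_mem hU hV')
    have h2 := congrArg Matrix.det h
    rwa [Matrix.det_mul, Matrix.det_transpose, Matrix.det_one] at h2
  have hs : Real.sign (U * Vᵀ).det = (U * Vᵀ).det := by
    rcases mul_self_eq_one_iff.1 hdet with h | h <;> rw [h] <;> norm_num [Real.sign]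
  rw [Matrix.mem_specialOrthogonalGroup_iff]
  constructor
  · refine mul_mem (mul_mem hU ?_) hV'
    rw [Matrix.mem_orthogonalGroup_iff, Matrix.diagonal_transpose, Matrix.diagonal_mul_diagonal,
      hs, ← Matrix.diagonal_one]
    congr 1
    funext i
    fin_cases i
    · simp
    · simp
    · simpa using hdet
  · unfold signedProduct
    rw [Matrix.det_mul, Matrix.det_mul, Matrix.det_diagonal, hs, Fin.prod_univ_three]
    rw [Matrix.det_mul] at hdet ⊢
    simp only [Matrix.cons_val_zero, Matrix.cons_val_one, Matrix.cons_val]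
    linarith

theorem exists_svdProj (A : Matrix (Fin 3) (Fin 3) ℝ) :
    ∃ R : SO3, ∃ U V σ, IsSVD A U V σ ∧ R.1 = signedProduct U V := by
  obtain ⟨U, V, σ, h⟩ := exists_isSVD A
  exact ⟨⟨_, signedProduct_mem h.left_mem h.right_mem⟩, U, V, σ, h, rfl⟩

/-- The SVD projection: `U diag(1, 1, sign (det (U Vᵀ))) Vᵀ` for some singular value
decomposition `A = U diag(σ) Vᵀ`. -/
def svdProj (A : Matrix (Fin 3) (Fin 3) ℝ) : SO3 := (exists_svdProj A).choose

/-! ### Spherical harmonics and Clebsch–Gordan coefficients -/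

/-- Index set of a degree-`l` feature; the index `a` stands for the order `m = a - l`. -/
abbrev Ord (l : ℕ) : Type := Fin (2 * l + 1)

/-- The order `m ∈ {-l, …, l}` belonging to an index. -/
def order (l : ℕ) (a : Ord l) : ℤ := (a : ℤ) - l

/-- The factorial of an integer (used at non-negative arguments). -/
def intFact (n : ℤ) : ℝ := (Nat.factorial n.toNat : ℝ)

/-- `1 / n!`, with value `0` at negative integers. -/
def invFact (n : ℤ) : ℝ := if 0 ≤ n then (intFact n)⁻¹ else 0

/-- The complex spherical harmonic `Y_l^m` (orthonormal, with the Condon–Shortley phase), written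
as a homogeneous harmonic polynomial of degree `l` in the Cartesian coordinates:
`√((2l+1)/(4π) (l+m)! (l-m)!) ∑ (-(x+iy)/2)^p ((x-iy)/2)^q z^s / (p! q! s!)`, the sum being over
`p + q + s = l`, `p - q = m`. -/
def complexHarmonic (l : ℕ) (m : ℤ) (x : Vec3) : ℂ :=
  (Real.sqrt ((2 * l + 1) / (4 * Real.pi) * (intFact (l + m) * intFact (l - m))) : ℂ) *
    ∑ p ∈ Finset.range (l + 1), ∑ q ∈ Finset.range (l + 1),
      if p + q ≤ l ∧ (p : ℤ) - q = m then
        (-((x 0 : ℂ) + Complex.I * x 1) / 2) ^ p * (((x 0 : ℂ) - Complex.I * x 1) / 2) ^ q *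
          (x 2 : ℂ) ^ (l - p - q) / ((p.factorial : ℂ) * (q.factorial : ℂ) * ((l - p - q).factorial : ℂ))
      else 0

/-- The unitary change of basis from complex to real spherical harmonics:
`Y_{l,0} = Y_l^0`, `Y_{l,a} = (Y_l^{-a} + (-1)^a Y_l^a)/√2` for `a > 0`, and
`Y_{l,a} = i (Y_l^a - (-1)^a Y_l^{-a})/√2` for `a < 0`. -/
def realBasis (a b : ℤ) : ℂ :=
  if a = 0 then (if b = 0 then 1 else 0)
  else if 0 < a then
    (if b = a then (-1) ^ a.natAbs else if b = -a then 1 else 0) / (Real.sqrt 2 : ℂ)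
  else
    Complex.I * (if b = a then 1 else if b = -a then -(-1) ^ a.natAbs else 0) / (Real.sqrt 2 : ℂ)

/-- The vector `Y_l(x) ∈ ℝ^{2l+1}` of real spherical harmonics of degree `l`, ordered by
`m = -l, …, l`. For instance `Y_1(x, y, z) = √(3/(4π)) (y, z, x)`. -/
def realHarmonic (l : ℕ) (x : Vec3) (a : Ord l) : ℝ :=
  (∑ b : Ord l, realBasis (order l a) (order l b) * complexHarmonic l (order l b) x).re

/-- The Clebsch–Gordan coefficient `⟨j₁ m₁ j₂ m₂ | J M⟩` (Racah's formula). -/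
def clebschGordan (j₁ : ℕ) (m₁ : ℤ) (j₂ : ℕ) (m₂ : ℤ) (J : ℕ) (M : ℤ) : ℝ :=
  if m₁ + m₂ = M ∧ J ≤ j₁ + j₂ ∧ j₁ ≤ j₂ + J ∧ j₂ ≤ j₁ + J then
    Real.sqrt ((2 * J + 1) *
        (intFact ((J : ℤ) + j₁ - j₂) * intFact ((J : ℤ) - j₁ + j₂) * intFact ((j₁ : ℤ) + j₂ - J)) /
        intFact ((j₁ : ℤ) + j₂ + J + 1)) *
    Real.sqrt (intFact (J + M) * intFact (J - M) * intFact (j₁ - m₁) * intFact (j₁ + m₁) *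
        intFact (j₂ - m₂) * intFact (j₂ + m₂)) *
    ∑ k ∈ Finset.range (j₁ + j₂ + 1), (-1 : ℝ) ^ k *
        (invFact k * invFact ((j₁ : ℤ) + j₂ - J - k) * invFact ((j₁ : ℤ) - m₁ - k) *
          invFact ((j₂ : ℤ) + m₂ - k) * invFact ((J : ℤ) - j₂ + m₁ + k) *
          invFact ((J : ℤ) - j₁ - m₂ + k))
  else 0

/-- The Clebsch–Gordan coefficient in the bases of real spherical harmonics. The phase
`i^{j₁+j₂+J}` makes the coefficients, which are all real or all purely imaginary, real. -/
def realClebschGordan (j₁ : ℕ) (a₁ : Ord j₁) (j₂ : ℕ) (a₂ : Ord j₂) (J : ℕ) (A : Ord J) : ℝ :=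
  (Complex.I ^ (j₁ + j₂ + J) *
    ∑ b₁ : Ord j₁, ∑ b₂ : Ord j₂, ∑ B : Ord J,
      realBasis (order j₁ a₁) (order j₁ b₁) * realBasis (order j₂ a₂) (order j₂ b₂) *
        star (realBasis (order J A) (order J B)) *
        (clebschGordan j₁ (order j₁ b₁) j₂ (order j₂ b₂) J (order J B) : ℂ)).re

/-- The degrees `J = |o - i|, …, o + i`. -/
def degrees (o i : ℕ) : Finset ℕ := Finset.Icc ((o : ℤ) - i).natAbs (o + i)

/-- The unit vector `x / ‖x‖`. -/
def unitVec (x : Vec3) : Vec3 := (len x)⁻¹ • x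

/-- The `SE(3)`-kernel of degrees `(o, i)` with radial functions `φ_J`. -/
def kernel3 (o i : ℕ) (φ : ℕ → ℝ → ℝ) (x : Vec3) : Matrix (Ord o) (Ord i) ℝ :=
  fun m₃ m₁ => ∑ J ∈ degrees o i, φ J (len x) *
    ∑ m₅ : Ord J, realClebschGordan i m₁ o m₃ J m₅ * realHarmonic J (unitVec x) m₅

/-- Points of `ℝ⁶`, `z = z¹ ⊕ z²`. -/
abbrev Vec6 : Type := Vec3 × Vec3

/-- Index set of a degree-`(p, q)` feature. -/
abbrev Ord6 (i : ℕ × ℕ) : Type := Ord i.1 × Ord i.2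

/-- The `SE(3) × SE(3)`-kernel of degrees `(o, i)` with radial functions `φ_{J₁,J₂}`. -/
def kernel6 (o i : ℕ × ℕ) (φ : ℕ → ℕ → ℝ → ℝ → ℝ) (z : Vec6) : Matrix (Ord6 o) (Ord6 i) ℝ :=
  fun m₃₄ m₁₂ => ∑ J₁ ∈ degrees o.1 i.1, ∑ J₂ ∈ degrees o.2 i.2, φ J₁ J₂ (len z.1) (len z.2) *
    ∑ m₅ : Ord J₁, ∑ m₆ : Ord J₂,
      (realClebschGordan i.1 m₁₂.1 o.1 m₃₄.1 J₁ m₅ * realClebschGordan i.2 m₁₂.2 o.2 m₃₄.2 J₂ m₆) *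
        (realHarmonic J₁ (unitVec z.1) m₅ * realHarmonic J₂ (unitVec z.2) m₆)

/-! ### Features, layers and networks -/

/-- A feature type: the number of channels of each degree, zero outside a finite set of degrees. -/
structure FeatType (I : Type) : Type where
  supp : Finset I
  ch : I → ℕ
  ch_eq_zero : ∀ i, i ∉ supp → ch i = 0

/-- Only `c` channels of degree `o`. -/
def FeatType.single {I : Type} [DecidableEq I] (o : I) (c : ℕ) : FeatType I where
  supp := {o}
  ch := fun i => if i = o then c else 0
  ch_eq_zero := fun i hi => by simp_all

section Layers

variable {I : Type} {ix : I → Type} [∀ i, Fintype (ix i)]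

/-- A feature `⊕_i F^i`: for every degree `i`, the `ch i` channels of degree `i`, each of them a
vector indexed by `ix i`. -/
abbrev Feature (ix : I → Type) (τ : FeatType I) : Type := (i : I) → Fin (τ.ch i) → ix i → ℝ

/-- Weights `W^i` mixing, for every degree `i`, the channels of degree `i`. -/
abbrev ChannelWeights (σ τ : FeatType I) : Type :=
  (i : I) → Matrix (Fin (τ.ch i)) (Fin (σ.ch i)) ℝ

/-- The feature `⊕_i W^i F^i`. -/
def mixChannels {σ τ : FeatType I} (W : ChannelWeights σ τ) (F : Feature ix σ) : Feature ix τ :=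
  fun i a m => ∑ b, W i a b * F i b m

/-- One kernel matrix for every output channel and every input channel. -/
abbrev Kernels (ix : I → Type) (σ τ : FeatType I) : Type :=
  (o : I) → Fin (τ.ch o) → (i : I) → Fin (σ.ch i) → Matrix (ix o) (ix i) ℝ

/-- The feature `⊕_o ∑_i 𝒲^{o,i} f^i`. -/
def applyKernels {σ τ : FeatType I} (𝒲 : Kernels ix σ τ) (f : Feature ix σ) : Feature ix τ :=
  fun o a => ∑ i ∈ σ.supp, ∑ b, 𝒲 o a i b *ᵥ f i b

/-- The inner product of two features. -/
def featInner {τ : FeatType I} (f g : Feature ix τ) : ℝ :=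
  ∑ i ∈ τ.supp, ∑ a, f i a ⬝ᵥ g i a

/-- The attention weight `α_{uv}` for queries `Q_u`, keys `K_{uv}` and neighbourhoods `N(u)`
(from which `u` has been removed). -/
def attention {n : ℕ} {κ : FeatType I} (N : Fin n → Finset (Fin n)) (Q : Fin n → Feature ix κ)
    (K : Fin n → Fin n → Feature ix κ) (u v : Fin n) : ℝ :=
  Real.exp (featInner (Q u) (K u v)) / ∑ v' ∈ N u, Real.exp (featInner (Q u) (K u v'))

/-- A transformer layer, for given self-interaction weights `W`, query weights `WQ`, key kernels
`𝒲K u v` and value kernels `𝒲V u v`. -/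
def transformerLayer {n : ℕ} {σ κ τ : FeatType I} (N : Fin n → Finset (Fin n))
    (W : ChannelWeights σ τ) (WQ : ChannelWeights σ κ) (𝒲K : Fin n → Fin n → Kernels ix σ κ)
    (𝒲V : Fin n → Fin n → Kernels ix σ τ) (f : Fin n → Feature ix σ) : Fin n → Feature ix τ :=
  fun u => mixChannels W (f u) +
    ∑ v ∈ N u,
      attention N (fun u => mixChannels WQ (f u)) (fun u v => applyKernels (𝒲K u v) (f v)) u v •
        applyKernels (𝒲V u v) (f v)

/-- The equivariant Relu of `F_μ` in the direction `F_ν`, on one channel. -/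
def eluVec {ι : Type} [Fintype ι] (Fμ Fν : ι → ℝ) : ι → ℝ :=
  if 0 ≤ Fμ ⬝ᵥ Fν then Fμ
  else
    Fμ - (Fμ ⬝ᵥ ((‖WithLp.toLp 2 Fν‖)⁻¹ • Fν)) • ((‖WithLp.toLp 2 Fν‖)⁻¹ • Fν)

/-- An Elu layer with weights `W_μ`, `W_ν`. -/
def eluLayer {n : ℕ} {τ : FeatType I} (Wμ Wν : ChannelWeights τ τ) (f : Fin n → Feature ix τ) :
    Fin n → Feature ix τ :=
  fun u i a => eluVec (mixChannels Wμ (f u) i a) (mixChannels Wν (f u) i a)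

end Layers

open Classical in
/-- The `k` nearest neighbours of `u` with respect to the distance `d`, ties being broken by the
order of the points, with `u` itself removed. -/
def neighbors {n : ℕ} (k : ℕ) (d : Fin n → Fin n → ℝ) (u : Fin n) : Finset (Fin n) :=
  Finset.univ.filter fun v : Fin n =>
    Set.ncard {w : Fin n | d u w < d u v ∨ (d u w = d u v ∧ w < v)} < k ∧ v ≠ u

/-- Euclidean distance in `ℝ³`. -/
def dist3 (x y : Vec3) : ℝ := len (x - y)

/-- Euclidean distance in `ℝ⁶`. -/
def dist6 (z w : Vec6) : ℝ := Real.sqrt (len (z.1 - w.1) ^ 2 + len (z.2 - w.2) ^ 2)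

/-- The learnable parameters of an `SE(3)`-transformer layer; `key` is the type of the queries and
keys, and `φK`, `φV` are the radial functions of the kernels in the keys and in the values. -/
structure Attn3 (σ τ : FeatType ℕ) : Type where
  key : FeatType ℕ
  W : ChannelWeights σ τ
  WQ : ChannelWeights σ key
  φK : (o : ℕ) → Fin (key.ch o) → (i : ℕ) → Fin (σ.ch i) → ℕ → ℝ → ℝ
  φV : (o : ℕ) → Fin (τ.ch o) → (i : ℕ) → Fin (σ.ch i) → ℕ → ℝ → ℝ

/-- An `SE(3)`-transformer layer on the points `X`. -/
def Attn3.eval {σ τ : FeatType ℕ} (L : Attn3 σ τ) (k : ℕ) {n : ℕ} (X : Cloud n)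
    (f : Fin n → Feature Ord σ) : Fin n → Feature Ord τ :=
  transformerLayer (neighbors k fun u v => dist3 (X u) (X v)) L.W L.WQ
    (fun u v o a i b => kernel3 o i (L.φK o a i b) (X v - X u))
    (fun u v o a i b => kernel3 o i (L.φV o a i b) (X v - X u)) f

/-- An `SE(3)`-transformer: a finite sequence of transformer layers and Elu layers. -/
inductive Net3 : FeatType ℕ → FeatType ℕ → Type
  | nil (τ : FeatType ℕ) : Net3 τ τ
  | attn {σ τ υ : FeatType ℕ} (L : Attn3 σ τ) (rest : Net3 τ υ) : Net3 σ υ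
  | elu {σ υ : FeatType ℕ} (Wμ Wν : ChannelWeights σ σ) (rest : Net3 σ υ) : Net3 σ υ

/-- Evaluation of an `SE(3)`-transformer (with `k` nearest neighbours) on the points `X`. -/
def Net3.eval (k : ℕ) {n : ℕ} (X : Cloud n) : {σ τ : FeatType ℕ} → Net3 σ τ →
    (Fin n → Feature Ord σ) → (Fin n → Feature Ord τ)
  | _, _, .nil _, f => f
  | _, _, .attn L rest, f => rest.eval k X (L.eval k X f)
  | _, _, .elu Wμ Wν rest, f => rest.eval k X (eluLayer Wμ Wν f)

/-- The learnable parameters of an `SE(3) × SE(3)`-transformer layer. -/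
structure Attn6 (σ τ : FeatType (ℕ × ℕ)) : Type where
  key : FeatType (ℕ × ℕ)
  W : ChannelWeights σ τ
  WQ : ChannelWeights σ key
  φK : (o : ℕ × ℕ) → Fin (key.ch o) → (i : ℕ × ℕ) → Fin (σ.ch i) → ℕ → ℕ → ℝ → ℝ → ℝ
  φV : (o : ℕ × ℕ) → Fin (τ.ch o) → (i : ℕ × ℕ) → Fin (σ.ch i) → ℕ → ℕ → ℝ → ℝ → ℝ

/-- An `SE(3) × SE(3)`-transformer layer on the points `Z`. -/
def Attn6.eval {σ τ : FeatType (ℕ × ℕ)} (L : Attn6 σ τ) (k : ℕ) {n : ℕ} (Z : Fin n → Vec6)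
    (f : Fin n → Feature Ord6 σ) : Fin n → Feature Ord6 τ :=
  transformerLayer (neighbors k fun u v => dist6 (Z u) (Z v)) L.W L.WQ
    (fun u v o a i b => kernel6 o i (L.φK o a i b) (Z v - Z u))
    (fun u v o a i b => kernel6 o i (L.φV o a i b) (Z v - Z u)) f

/-- An `SE(3) × SE(3)`-transformer: a finite sequence of transformer layers and Elu layers. -/
inductive Net6 : FeatType (ℕ × ℕ) → FeatType (ℕ × ℕ) → Type
  | nil (τ : FeatType (ℕ × ℕ)) : Net6 τ τ
  | attn {σ τ υ : FeatType (ℕ × ℕ)} (L : Attn6 σ τ) (rest : Net6 τ υ) : Net6 σ υ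
  | elu {σ υ : FeatType (ℕ × ℕ)} (Wμ Wν : ChannelWeights σ σ) (rest : Net6 σ υ) : Net6 σ υ

/-- Evaluation of an `SE(3) × SE(3)`-transformer (with `k` nearest neighbours) on the points `Z`. -/
def Net6.eval (k : ℕ) {n : ℕ} (Z : Fin n → Vec6) : {σ τ : FeatType (ℕ × ℕ)} → Net6 σ τ →
    (Fin n → Feature Ord6 σ) → (Fin n → Feature Ord6 τ)
  | _, _, .nil _, f => f
  | _, _, .attn L rest, f => rest.eval k Z (L.eval k Z f)
  | _, _, .elu Wμ Wν rest, f => rest.eval k Z (eluLayer Wμ Wν f)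

/-- The feature of type `single o c` whose channel `a` is constantly `b a`. -/
def constFeature {I : Type} [DecidableEq I] (ix : I → Type) (o : I) {c : ℕ} (b : Fin c → ℝ) :
    Feature ix (FeatType.single o c) :=
  fun i a _ => b (a.castLE (by simp only [FeatType.single]; split <;> simp))

/-- The type of the fused features: the degree-`0` channels are doubled. -/
def FeatType.fuse (τ : FeatType ℕ) : FeatType ℕ where
  supp := τ.supp
  ch := fun
    | 0 => τ.ch 0 + τ.ch 0
    | p + 1 => τ.ch (p + 1)
  ch_eq_zero := fun i hi => by
    cases i with
    | zero => simp [τ.ch_eq_zero 0 hi]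
    | succ p => exact τ.ch_eq_zero _ hi

/-- Fusion: to the degree-`0` features of `f` at each point, the average of the degree-`0`
features of `g` is appended; the features of positive degree are kept. -/
def fuse {τ : FeatType ℕ} {n m : ℕ} (f : Fin n → Feature Ord τ) (g : Fin m → Feature Ord τ) :
    Fin n → Feature Ord τ.fuse :=
  fun u i => match i with
    | 0 => Fin.append (f u 0) (pool fun v => g v 0)
    | p + 1 => f u (p + 1)

/-! ### The full model -/

/-- A tensor field on `L` points of `ℝ⁶`. -/
structure Field6 (L : ℕ) (τ : FeatType (ℕ × ℕ)) : Type where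
  pos : Fin L → Vec6
  feat : Fin L → Feature Ord6 τ

/-- The architecture and the learnable parameters of the model. -/
structure Model : Type where
  /-- number of nearest neighbours in the `SE(3)`-transformer -/
  k3 : ℕ
  /-- constant degree-`0` input features of the `SE(3)`-transformer -/
  in3 : ℕ
  bias3 : Fin in3 → ℝ
  /-- the part of the `SE(3)`-transformer before the fusion of features -/
  mid3 : FeatType ℕ
  body3 : Net3 (FeatType.single 0 in3) mid3
  /-- the part of the `SE(3)`-transformer after the fusion of features -/
  out3 : FeatType ℕ
  last3 : Net3 mid3.fuse out3
  /-- number of nearest neighbours in the `SE(3) × SE(3)`-transformer -/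
  k6 : ℕ
  /-- constant degree-`(0, 0)` input features of the `SE(3) × SE(3)`-transformer -/
  in6 : ℕ
  bias6 : Fin in6 → ℝ
  out6 : FeatType (ℕ × ℕ)
  net6 : Net6 (FeatType.single (0, 0) in6) out6
  /-- the output channels of degree `(1, 1)`, `(1, 0)` and `(0, 1)` that enter the projection -/
  chR : Fin (out6.ch (1, 1))
  chX : Fin (out6.ch (1, 0))
  chY : Fin (out6.ch (0, 1))

namespace Model

variable (Φ : Model)

/-- The number of key points: the number of degree-`0` output channels of the
`SE(3)`-transformer. -/
abbrev L : ℕ := Φ.out3.ch 0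

/-- The features of `X` before fusion. -/
def body {n : ℕ} (X : Cloud n) : Fin n → Feature Ord Φ.mid3 :=
  Φ.body3.eval Φ.k3 X fun _ => constFeature Ord 0 Φ.bias3

/-- The key-point weights `F_X⁰ ∈ ℝ^{L × n}` of the points of `X`, when the other cloud is `Y`. -/
def weights {n m : ℕ} (X : Cloud n) (Y : Cloud m) : Matrix (Fin Φ.L) (Fin n) ℝ :=
  fun l u => Φ.last3.eval Φ.k3 X (fuse (Φ.body X) (Φ.body Y)) u 0 l 0

/-- The row-wise softmax. -/
def softmax {l n : ℕ} (F : Matrix (Fin l) (Fin n) ℝ) : Matrix (Fin l) (Fin n) ℝ :=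
  fun a u => Real.exp (F a u) / ∑ v, Real.exp (F a v)

/-- The key points `SoftMax(F_X⁰) X` of `X`, when the other cloud is `Y`. -/
def keyPoints {n m : ℕ} (X : Cloud n) (Y : Cloud m) : Cloud Φ.L :=
  fun a => ∑ u, softmax (Φ.weights X Y) a u • X u

/-- `Φ_S`: merge the key points of the clouds to a cloud in `ℝ⁶` and apply the
`SE(3) × SE(3)`-transformer. -/
def ΦS {M N : ℕ} (X : Cloud M) (Y : Cloud N) : Field6 Φ.L Φ.out6 :=
  let Z : Fin Φ.L → Vec6 := fun u => (Φ.keyPoints X Y u, Φ.keyPoints Y X u)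
  ⟨Z, Φ.net6.eval Φ.k6 Z fun _ => constFeature Ord6 (0, 0) Φ.bias6⟩

/-- The index, in a degree-`1` feature, of a Cartesian coordinate: the orders `m = -1, 0, 1` are
the coordinates `y, z, x`. -/
def cart : Fin 3 → Ord 1 := ![2, 0, 1]

/-- `r̂ = unvec(Pool_u f_u^{1,1})`, in Cartesian coordinates (columns belong to the first
factor). -/
def rHat {l : ℕ} (f : Field6 l Φ.out6) : Matrix (Fin 3) (Fin 3) ℝ :=
  fun i j => pool (fun u => f.feat u (1, 1) Φ.chR) (cart j, cart i)

/-- `t_X = Pool_u f_u^{1,0}`, in Cartesian coordinates. -/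
def tX {l : ℕ} (f : Field6 l Φ.out6) : Vec3 :=
  fun i => pool (fun u => f.feat u (1, 0) Φ.chX) (cart i, 0)

/-- `t_Y = Pool_u f_u^{0,1}`, in Cartesian coordinates. -/
def tY {l : ℕ} (f : Field6 l Φ.out6) : Vec3 :=
  fun i => pool (fun u => f.feat u (0, 1) Φ.chY) (0, cart i)

/-- `Φ_P`: the Arun-type projection of a tensor field to `SE(3)`. -/
def ΦP {l : ℕ} (f : Field6 l Φ.out6) : SE3 where
  rot := svdProj (Φ.rHat f)
  trans := (pool (fun u => (f.pos u).2) + Φ.tY f) -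
    (svdProj (Φ.rHat f)).1 *ᵥ (pool (fun u => (f.pos u).1) + Φ.tX f)

end Model

end

end BITR

/-! Everything rests on one fact: for each rotation `R` there are real orthogonal matrices `D l`
with `Y_l(R x) = D l Y_l(x)` such that the Clebsch–Gordan matrices intertwine `D j₁ ⊗ D j₂` with `D
J` (`IsWigner`, `exists_isWigner`).

It is proved with binary forms. Paired with the normalized monomials of degree `2l` in `w`, the
harmonics give a multiple of `nullForm x w ^ l`, and the Clebsch–Gordan coefficients give a multiple
of `(p₀q₁ - p₁q₀)^a (p·w)^b (q·w)^c`. If `g ∈ SU(2)` lifts `R`, substituting `g` carries the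
quadratic form of `x` to that of `R x` and preserves the bracket, so both covariances follow by
comparing coefficients (`complexHarmonicVec_mulVec`, `cgMatrix_covariant`). The symmetric powers of
`g` are real and orthogonal in the basis of real harmonics (`star_realSymPow`). Lifts are written
down for rotations about two axes; Euler angles give the rest.

Consequently kernels satisfy `𝒲(R x) D_i = D_o 𝒲(x)`. Layers see only relative positions, distances
and inner products, so networks commute with the action, for `ℝ⁶` with `D ⊗ E`. As `D 0 = 1`, the
softmax weights are invariant, and key points, being affine combinations, move with their cloud. As
`D 1` is `R` in Cartesian coordinates, `r̂` becomes `R₂ r̂ R₁ᵀ`, while `t_X` and `t_Y` rotate.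

Finally, `signedProduct U V` maximizes `tr (Sᵀ A)` over `S ∈ SO(3)`, and the gap `σ₃ < σ₂` makes the
maximizer unique. The projection is therefore independent of the chosen decomposition and
bi-equivariant (`svdProj_mul_mul`); the formula for `t` then gives the claim. -/

namespace BITR

open Matrix

open scoped Kronecker

noncomputable section

/-! ### Binary forms -/

/-- The normalized monomials `w₀^a w₁^(2l-a) / √(a! (2l-a)!)` of degree `2l`. -/
def monoVec (l : ℕ) (w : Fin 2 → ℂ) (a : Ord l) : ℂ :=
  w 0 ^ (a : ℕ) * w 1 ^ (2 * l - a) /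
    (Real.sqrt ((Nat.factorial a : ℝ) * (Nat.factorial (2 * l - a) : ℝ)) : ℂ)

theorem sqrt_factorial_ne_zero (a b : ℕ) :
    (Real.sqrt ((Nat.factorial a : ℝ) * (Nat.factorial b : ℝ)) : ℂ) ≠ 0 := by
  have h : 0 < Real.sqrt ((Nat.factorial a : ℝ) * (Nat.factorial b : ℝ)) :=
    Real.sqrt_pos.2 (by positivity)
  exact_mod_cast h.ne'

theorem sqrt_factorial_mul_self (a b : ℕ) :
    (Real.sqrt ((Nat.factorial a : ℝ) * (Nat.factorial b : ℝ)) : ℂ) *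
      (Real.sqrt ((Nat.factorial a : ℝ) * (Nat.factorial b : ℝ)) : ℂ) =
      (Nat.factorial a : ℂ) * (Nat.factorial b : ℂ) := by
  have h := Real.mul_self_sqrt
    (show (0 : ℝ) ≤ (Nat.factorial a : ℝ) * (Nat.factorial b : ℝ) by positivity)
  exact_mod_cast h

/-- At the points `(j, 1)`, `j = 0, …, 2l`, the vanishing is a Vandermonde system for the rescaled
coefficients. -/
theorem eq_zero_of_monoVec {l : ℕ} {c : Ord l → ℂ} (h : ∀ w, c ⬝ᵥ monoVec l w = 0) : c = 0 := by
  have key : (fun a : Ord l => c a /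
      (Real.sqrt ((Nat.factorial a : ℝ) * (Nat.factorial (2 * l - a) : ℝ)) : ℂ)) = 0 := by
    refine Matrix.eq_zero_of_forall_index_sum_mul_pow_eq_zero
      (f := fun j : Ord l => ((j : ℕ) : ℂ)) (fun i j hij => ?_) fun j => ?_
    · exact Fin.ext (Nat.cast_injective (R := ℂ) hij)
    · rw [← h ![(j : ℂ), 1]]
      refine Finset.sum_congr rfl fun a _ => ?_
      simp [monoVec]
      ring
  funext a
  have h1 := congrFun key a
  exact (div_eq_zero_iff.1 h1).resolve_right (sqrt_factorial_ne_zero _ _)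

theorem ext_of_monoVec {l : ℕ} {c d : Ord l → ℂ}
    (h : ∀ w, c ⬝ᵥ monoVec l w = d ⬝ᵥ monoVec l w) : c = d :=
  sub_eq_zero.1 (eq_zero_of_monoVec fun w => by rw [sub_dotProduct, h, sub_self])

theorem matrix_ext_of_monoVec {ι : Type*} {l : ℕ} {A B : Matrix ι (Ord l) ℂ}
    (h : ∀ w, A *ᵥ monoVec l w = B *ᵥ monoVec l w) : A = B := by
  funext i
  exact ext_of_monoVec fun w => congrFun (h w) i

/-- The binomial theorem. The square roots in `monoVec` are chosen so that this pairing depends on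
`p ⬝ᵥ w` alone. -/
theorem monoVec_dotProduct (l : ℕ) (p w : Fin 2 → ℂ) :
    monoVec l p ⬝ᵥ monoVec l w = (p ⬝ᵥ w) ^ (2 * l) / (Nat.factorial (2 * l) : ℂ) := by
  have hp : p ⬝ᵥ w = p 0 * w 0 + p 1 * w 1 := by simp [dotProduct, Fin.sum_univ_two]
  rw [hp, add_pow, Finset.sum_range, Finset.sum_div]
  refine Finset.sum_congr rfl fun a _ => ?_
  have ha : (a : ℕ) ≤ 2 * l := by omega
  have h1 := sqrt_factorial_mul_self a (2 * l - a)
  have h2 := sqrt_factorial_ne_zero a (2 * l - a)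
  have h3 := Nat.choose_mul_factorial_mul_factorial ha
  have h4 : ((2 * l).choose a : ℂ) * (Nat.factorial a : ℂ) * (Nat.factorial (2 * l - a) : ℂ) =
      (Nat.factorial (2 * l) : ℂ) := by exact_mod_cast h3
  have h5 : (Nat.factorial (2 * l) : ℂ) ≠ 0 := by exact_mod_cast Nat.factorial_ne_zero _
  unfold monoVec
  rw [div_mul_div_comm, h1, div_eq_div_iff _ h5, ← h4, mul_pow, mul_pow]
  · ring
  · rw [← h1]; exact mul_ne_zero h2 h2

/-- Forms of degree `n` in two variables, as functions. -/
def formSpace (n : ℕ) : Submodule ℂ ((Fin 2 → ℂ) → ℂ) :=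
  Submodule.span ℂ (Set.range fun k : Fin (n + 1) => fun w : Fin 2 → ℂ =>
    w 0 ^ (k : ℕ) * w 1 ^ (n - k))

theorem monomial_mem_formSpace {n i j : ℕ} (h : i + j = n) :
    (fun w : Fin 2 → ℂ => w 0 ^ i * w 1 ^ j) ∈ formSpace n :=
  Submodule.subset_span ⟨⟨i, by omega⟩, by
    have : n - i = j := by omega
    simp [this]⟩

theorem linear_mul_mem_formSpace {n : ℕ} {f : (Fin 2 → ℂ) → ℂ} (hf : f ∈ formSpace n)
    (p : Fin 2 → ℂ) : (fun w => (p ⬝ᵥ w) * f w) ∈ formSpace (n + 1) := by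
  induction hf using Submodule.span_induction with
  | mem f hf =>
    obtain ⟨k, rfl⟩ := hf
    have h0 : (fun w : Fin 2 → ℂ => w 0 ^ ((k : ℕ) + 1) * w 1 ^ (n - k)) ∈ formSpace (n + 1) :=
      monomial_mem_formSpace (by omega)
    have h1 : (fun w : Fin 2 → ℂ => w 0 ^ (k : ℕ) * w 1 ^ (n - k + 1)) ∈ formSpace (n + 1) :=
      monomial_mem_formSpace (by omega)
    convert add_mem (Submodule.smul_mem _ (p 0) h0) (Submodule.smul_mem _ (p 1) h1) using 1
    funext w
    simp only [dotProduct, Fin.sum_univ_two, Pi.add_apply, Pi.smul_apply, smul_eq_mul]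
    ring
  | zero =>
    convert (formSpace (n + 1)).zero_mem using 1
    funext w
    simp
  | add f g _ _ hf hg =>
    convert add_mem hf hg using 1
    funext w
    simp [mul_add]
  | smul c f _ hf =>
    convert Submodule.smul_mem _ c hf using 1
    funext w
    simp
    ring

theorem pow_mul_pow_mem_formSpace (p q : Fin 2 → ℂ) (a b : ℕ) :
    (fun w => (p ⬝ᵥ w) ^ a * (q ⬝ᵥ w) ^ b) ∈ formSpace (a + b) := by
  induction a with
  | zero =>
    induction b with
    | zero => simpa using monomial_mem_formSpace (n := 0) (i := 0) (j := 0) rfl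
    | succ b ih =>
      have h := linear_mul_mem_formSpace ih q
      rw [add_assoc] at h
      convert h using 1
      funext w; ring
  | succ a ih =>
    have h := linear_mul_mem_formSpace ih p
    rw [show a + 1 + b = a + b + 1 by ring]
    convert h using 1
    funext w; ring

/-- After substitution each monomial is a product of `2l` linear forms, hence lies in the span of
the monomials of degree `2l`. -/
theorem exists_symPow (l : ℕ) (g : Matrix (Fin 2) (Fin 2) ℂ) :
    ∃ T : Matrix (Ord l) (Ord l) ℂ, ∀ w, monoVec l (g *ᵥ w) = T *ᵥ monoVec l w := by
  have h : ∀ a : Ord l, ∃ t : Ord l → ℂ, ∀ w, monoVec l (g *ᵥ w) a = t ⬝ᵥ monoVec l w := by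
    intro a
    have h1 := pow_mul_pow_mem_formSpace (g 0) (g 1) a (2 * l - a)
    rw [show (a : ℕ) + (2 * l - a) = 2 * l by omega] at h1
    obtain ⟨c, hc⟩ := (Submodule.mem_span_range_iff_exists_fun ℂ).1 h1
    -- The square roots convert coefficients with respect to plain monomials into coefficients with
    -- respect to normalized ones.
    refine ⟨fun b => c b *
      (Real.sqrt ((Nat.factorial b : ℝ) * (Nat.factorial (2 * l - b) : ℝ)) : ℂ) /
      (Real.sqrt ((Nat.factorial a : ℝ) * (Nat.factorial (2 * l - a) : ℝ)) : ℂ), fun w => ?_⟩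
    have h2 := congrFun hc w
    simp only [Finset.sum_apply, Pi.smul_apply, smul_eq_mul] at h2
    rw [monoVec, mulVec, mulVec, ← h2, Finset.sum_div]
    refine Finset.sum_congr rfl fun b _ => ?_
    have h3 := sqrt_factorial_ne_zero b (2 * l - b)
    rw [monoVec]
    field_simp
  choose T hT using h
  exact ⟨T, fun w => funext fun a => hT a w⟩

/-- The matrix by which a linear substitution acts on the normalized monomials of degree `2l`. -/
def symPow (l : ℕ) (g : Matrix (Fin 2) (Fin 2) ℂ) : Matrix (Ord l) (Ord l) ℂ :=
  (exists_symPow l g).choose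

theorem monoVec_mulVec (l : ℕ) (g : Matrix (Fin 2) (Fin 2) ℂ) (w : Fin 2 → ℂ) :
    monoVec l (g *ᵥ w) = symPow l g *ᵥ monoVec l w :=
  (exists_symPow l g).choose_spec w

theorem symPow_mul (l : ℕ) (g h : Matrix (Fin 2) (Fin 2) ℂ) :
    symPow l (g * h) = symPow l g * symPow l h :=
  matrix_ext_of_monoVec fun w => by
    rw [← monoVec_mulVec, ← mulVec_mulVec, ← mulVec_mulVec, monoVec_mulVec, monoVec_mulVec]

theorem symPow_one (l : ℕ) : symPow l 1 = 1 :=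
  matrix_ext_of_monoVec fun w => by rw [← monoVec_mulVec, one_mulVec, one_mulVec]

/-- The pairing of two monomial vectors depends only on `p ⬝ᵥ w`, through which `g` moves to the
other side as its transpose. Together with `symPow_map_star` this makes symmetric powers of unitary
matrices unitary. -/
theorem symPow_transpose (l : ℕ) (g : Matrix (Fin 2) (Fin 2) ℂ) :
    symPow l gᵀ = (symPow l g)ᵀ :=
  matrix_ext_of_monoVec fun w => ext_of_monoVec fun v => by
    rw [← monoVec_mulVec, monoVec_dotProduct, mulVec_transpose, mulVec_transpose,
      ← dotProduct_mulVec, ← dotProduct_mulVec, ← monoVec_mulVec, monoVec_dotProduct]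

theorem star_monoVec (l : ℕ) (w : Fin 2 → ℂ) : star (monoVec l w) = monoVec l (star w) := by
  funext a
  simp [monoVec]

theorem symPow_map_star (l : ℕ) (g : Matrix (Fin 2) (Fin 2) ℂ) :
    symPow l (g.map star) = (symPow l g).map star := by
  have hs {m n : Type} [Fintype n] (A : Matrix m n ℂ) (v : n → ℂ) :
      A.map star *ᵥ v = star (A *ᵥ star v) := by
    funext i
    simp [mulVec, dotProduct]
  refine matrix_ext_of_monoVec fun w => ?_
  rw [← monoVec_mulVec, hs, hs, star_monoVec, ← monoVec_mulVec, star_monoVec]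

theorem symPow_conjTranspose (l : ℕ) (g : Matrix (Fin 2) (Fin 2) ℂ) :
    symPow l gᴴ = (symPow l g)ᴴ := by
  rw [conjTranspose, conjTranspose, symPow_map_star, symPow_transpose]

/-- Symmetric powers of an element of `SU(2)` are compatible with the real structure
`v_m ↦ (-1)^m conj v_{-m}`. -/
theorem symPow_rev {g : Matrix (Fin 2) (Fin 2) ℂ}
    (h₀ : g 1 1 = star (g 0 0)) (h₁ : g 1 0 = -star (g 0 1)) (l : ℕ) (a b : Ord l) :
    star (symPow l g a b) = (-1) ^ (a : ℕ) * (-1) ^ (b : ℕ) * symPow l g a.rev b.rev := by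
  -- The hypotheses on `g` amount to `conj g * ε = ε * g`. The symmetric power of `ε` is
  -- antidiagonal with alternating signs, so applying `symPow` to this relation gives the claim.
  let ε : Matrix (Fin 2) (Fin 2) ℂ := !![0, -1; 1, 0]
  have hε : symPow l ε = Matrix.of fun a b : Ord l => if b = a.rev then (-1) ^ (a : ℕ) else 0 := by
    refine matrix_ext_of_monoVec fun w => ?_
    rw [← monoVec_mulVec]
    funext c
    simp only [mulVec, dotProduct, of_apply, ite_mul, zero_mul, Finset.sum_ite_eq',
      Finset.mem_univ, if_true]
    have h1 : 2 * l + 1 - ((c : ℕ) + 1) = 2 * l - c := by omega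
    have h2 : 2 * l - (2 * l - (c : ℕ)) = c := by omega
    simp only [monoVec, ε, Fin.val_rev, h1, h2, mulVec, dotProduct, Fin.sum_univ_two]
    simp only [of_apply, cons_val', cons_val_zero, cons_val_one, cons_val_fin_one, zero_mul,
      neg_mul, one_mul, zero_add, add_zero, neg_pow (w 1)]
    rw [mul_comm (Nat.factorial (2 * l - (c : ℕ)) : ℝ)]
    ring
  have hc : g.map star * ε = ε * g := by
    ext i j
    fin_cases i <;> fin_cases j <;> simp [ε, mul_apply, Fin.sum_univ_two, h₀, h₁]
  have h := congrArg (symPow l) hc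
  rw [symPow_mul, symPow_mul, symPow_map_star, hε] at h
  have h2 := congrFun (congrFun h a) b.rev
  simp only [mul_apply, map_apply, of_apply, mul_ite, mul_zero, ite_mul, zero_mul,
    Fin.rev_inj, Finset.sum_ite_eq, Finset.sum_ite_eq', Finset.mem_univ, if_true] at h2
  rw [mul_right_comm, ← h2, mul_assoc, ← pow_add, ← two_mul, pow_mul]
  simp

/-! ### Generating function of the spherical harmonics -/

theorem add_pow_div_factorial (x y : ℂ) (n : ℕ) :
    (x + y) ^ n / (Nat.factorial n : ℂ) = ∑ k ∈ Finset.range (n + 1),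
      x ^ k / (Nat.factorial k : ℂ) * (y ^ (n - k) / (Nat.factorial (n - k) : ℂ)) := by
  rw [add_pow, Finset.sum_div]
  refine Finset.sum_congr rfl fun k hk => ?_
  have hk' : k ≤ n := by simpa [Nat.lt_succ_iff] using hk
  have h : (n.choose k : ℂ) * (Nat.factorial k : ℂ) * (Nat.factorial (n - k) : ℂ) =
      (Nat.factorial n : ℂ) := by exact_mod_cast Nat.choose_mul_factorial_mul_factorial hk'
  have h1 : (Nat.factorial k : ℂ) ≠ 0 := by exact_mod_cast Nat.factorial_ne_zero _
  have h2 : (Nat.factorial (n - k) : ℂ) ≠ 0 := by exact_mod_cast Nat.factorial_ne_zero _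
  have h3 : (Nat.factorial n : ℂ) ≠ 0 := by exact_mod_cast Nat.factorial_ne_zero _
  rw [div_mul_div_comm, div_eq_div_iff h3 (mul_ne_zero h1 h2), ← h]
  ring

theorem add_add_pow_div_factorial (x y z : ℂ) (n : ℕ) :
    (x + y + z) ^ n / (Nat.factorial n : ℂ) =
      ∑ p ∈ Finset.range (n + 1), ∑ q ∈ Finset.range (n + 1),
        if p + q ≤ n then x ^ p * y ^ q * z ^ (n - p - q) /
          ((Nat.factorial p : ℂ) * (Nat.factorial q : ℂ) * (Nat.factorial (n - p - q) : ℂ))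
        else 0 := by
  rw [add_assoc, add_pow_div_factorial]
  refine Finset.sum_congr rfl fun p hp => ?_
  have hp' : p ≤ n := by simpa [Nat.lt_succ_iff] using hp
  rw [add_pow_div_factorial, Finset.mul_sum, ← Finset.sum_filter]
  refine Finset.sum_congr ?_ fun q _ => ?_
  · ext q
    simp only [Finset.mem_range, Finset.mem_filter]
    omega
  · rw [div_mul_div_comm, div_mul_div_comm]
    congr 1 <;> ring

/-- The quadratic form whose powers generate the spherical harmonics. -/
def nullForm (x : Vec3) (w : Fin 2 → ℂ) : ℂ :=
  -((x 0 : ℂ) + Complex.I * x 1) / 2 * w 0 ^ 2 + ((x 0 : ℂ) - Complex.I * x 1) / 2 * w 1 ^ 2 +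
    (x 2 : ℂ) * (w 0 * w 1)

theorem mul_mul_mul_div_cancel {s : ℂ} (hs : s ≠ 0) (c x m : ℂ) :
    c * s * x * (m / s) = c * x * m := by
  field_simp

theorem intFact_add_order (l : ℕ) (b : Ord l) :
    intFact (l + order l b) = (Nat.factorial b : ℝ) := by
  have : (l + order l b).toNat = b := by simp only [order]; omega
  rw [intFact, this]

theorem intFact_sub_order (l : ℕ) (b : Ord l) :
    intFact (l - order l b) = (Nat.factorial (2 * l - b) : ℝ) := by
  have : ((l : ℤ) - order l b).toNat = 2 * l - b := by simp only [order]; omega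
  rw [intFact, this]

/-- The vector of complex spherical harmonics of degree `l`. -/
def complexHarmonicVec (l : ℕ) (x : Vec3) : Ord l → ℂ :=
  fun b => complexHarmonic l (order l b) x

/-- Trinomial expansion of `nullForm x w ^ l`: the exponents `p, q, s` contribute to `w₀^(2p+s)
w₁^(2q+s)`, and the factor `√((l+m)! (l-m)!)` of the harmonic cancels the denominator of `monoVec`.
-/
theorem complexHarmonicVec_dotProduct (l : ℕ) (x : Vec3) (w : Fin 2 → ℂ) :
    complexHarmonicVec l x ⬝ᵥ monoVec l w =
      (Real.sqrt ((2 * l + 1) / (4 * Real.pi)) : ℂ) *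
        (nullForm x w ^ l / (Nat.factorial l : ℂ)) := by
  rw [nullForm, add_add_pow_div_factorial, Finset.mul_sum, dotProduct]
  have h (b : Ord l) : complexHarmonicVec l x b * monoVec l w b =
      ∑ p ∈ Finset.range (l + 1), ∑ q ∈ Finset.range (l + 1),
        if p + q ≤ l ∧ (p : ℤ) - q = order l b then
          (Real.sqrt ((2 * l + 1) / (4 * Real.pi)) : ℂ) *
          ((-((x 0 : ℂ) + Complex.I * x 1) / 2) ^ p * (((x 0 : ℂ) - Complex.I * x 1) / 2) ^ q *
          (x 2 : ℂ) ^ (l - p - q) / ((p.factorial : ℂ) * (q.factorial : ℂ) *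
            ((l - p - q).factorial : ℂ))) * (w 0 ^ (b : ℕ) * w 1 ^ (2 * l - b))
        else 0 := by
    rw [complexHarmonicVec, complexHarmonic, intFact_add_order, intFact_sub_order,
      Real.sqrt_mul (by positivity), Complex.ofReal_mul, monoVec]
    have h1 := sqrt_factorial_ne_zero b (2 * l - b)
    generalize (Real.sqrt ((Nat.factorial b : ℝ) * (Nat.factorial (2 * l - b) : ℝ)) : ℂ) = s at *
    rw [Finset.mul_sum, Finset.sum_mul]
    refine Finset.sum_congr rfl fun p _ => ?_
    rw [Finset.mul_sum, Finset.sum_mul]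
    refine Finset.sum_congr rfl fun q _ => ?_
    split_ifs
    · exact mul_mul_mul_div_cancel h1 _ _ _
    · simp
  simp only [h]
  rw [Finset.sum_comm]
  refine Finset.sum_congr rfl fun p _ => ?_
  rw [Finset.sum_comm, Finset.mul_sum]
  refine Finset.sum_congr rfl fun q _ => ?_
  split_ifs with hpq
  -- The order `p - q` has index `l + p - q`, which is also the exponent `2p + (l - p - q)` of `w
  -- 0`.
  · rw [Finset.sum_eq_single (⟨l + p - q, by omega⟩ : Ord l)]
    · rw [if_pos ⟨hpq, by simp only [order]; omega⟩]
      have e1 : l + p - q = 2 * p + (l - p - q) := by omega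
      have e2 : 2 * l - (l + p - q) = 2 * q + (l - p - q) := by omega
      simp only [e2]
      simp only [e1, mul_pow, pow_add, ← pow_mul]
      ring
    · intro b _ hb
      refine if_neg fun h => hb (Fin.ext ?_)
      have := h.2
      simp only [order] at this ⊢
      omega
    · simp
  · simp [hpq]

theorem complexHarmonicVec_mulVec {g : Matrix (Fin 2) (Fin 2) ℂ} {x y : Vec3}
    (h : ∀ w, nullForm y w = nullForm x (gᵀ *ᵥ w)) (l : ℕ) :
    complexHarmonicVec l y = symPow l g *ᵥ complexHarmonicVec l x :=
  ext_of_monoVec fun w => by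
    rw [complexHarmonicVec_dotProduct, h, ← complexHarmonicVec_dotProduct, monoVec_mulVec,
      symPow_transpose, dotProduct_mulVec, vecMul_transpose]

/-! ### Generating function of the Clebsch–Gordan coefficients -/

theorem invFact_natCast (n : ℕ) : invFact n = (Nat.factorial n : ℝ)⁻¹ := by
  simp [invFact, intFact]

theorem nonneg_of_invFact_ne_zero {n : ℤ} (h : invFact n ≠ 0) : 0 ≤ n := by
  by_contra hn
  exact h (if_neg hn)

/-- A summand of Racah's formula, the sign included. -/
def racahTerm (j₁ : ℕ) (m₁ : ℤ) (j₂ : ℕ) (m₂ : ℤ) (J : ℕ) (k : ℕ) : ℝ :=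
  (-1 : ℝ) ^ k *
    (invFact k * invFact ((j₁ : ℤ) + j₂ - J - k) * invFact ((j₁ : ℤ) - m₁ - k) *
      invFact ((j₂ : ℤ) + m₂ - k) * invFact ((J : ℤ) - j₂ + m₁ + k) *
      invFact ((J : ℤ) - j₁ - m₂ + k))

/-- The generating function of the summands of Racah's formula. -/
theorem sum_racahTerm {j₁ j₂ J a b c : ℕ} (ha : a + J = j₁ + j₂) (hb : b + j₂ = j₁ + J)
    (hc : c + j₁ = j₂ + J) (p q w : Fin 2 → ℂ) :
    ∑ x : Ord j₁ × Ord j₂ × Ord J × Fin (j₁ + j₂ + 1),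
      (if order j₁ x.1 + order j₂ x.2.1 = order J x.2.2.1 then
        (racahTerm j₁ (order j₁ x.1) j₂ (order j₂ x.2.1) J x.2.2.2 : ℂ) *
        ((p 0 ^ (x.1 : ℕ) * p 1 ^ (2 * j₁ - x.1)) * (q 0 ^ (x.2.1 : ℕ) * q 1 ^ (2 * j₂ - x.2.1)) *
          (w 0 ^ (x.2.2.1 : ℕ) * w 1 ^ (2 * J - x.2.2.1)))
      else 0) =
    ((p 0 * q 1 - p 1 * q 0) ^ a / (Nat.factorial a : ℂ)) *
      ((p ⬝ᵥ w) ^ b / (Nat.factorial b : ℂ)) * ((q ⬝ᵥ w) ^ c / (Nat.factorial c : ℂ)) := by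
  have e1 : p 0 * q 1 - p 1 * q 0 = -(p 1 * q 0) + p 0 * q 1 := by ring
  have e2 : p ⬝ᵥ w = p 1 * w 1 + p 0 * w 0 := by
    simp only [dotProduct, Fin.sum_univ_two]; ring
  have e3 : q ⬝ᵥ w = q 0 * w 0 + q 1 * w 1 := by simp only [dotProduct, Fin.sum_univ_two]
  have e4 : ((p 0 * q 1 - p 1 * q 0) ^ a / (Nat.factorial a : ℂ)) *
      ((p ⬝ᵥ w) ^ b / (Nat.factorial b : ℂ)) * ((q ⬝ᵥ w) ^ c / (Nat.factorial c : ℂ)) =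
      ∑ y : Fin (a + 1) × Fin (b + 1) × Fin (c + 1),
        ((-(p 1 * q 0)) ^ (y.1 : ℕ) / (Nat.factorial y.1 : ℂ) *
          ((p 0 * q 1) ^ (a - y.1) / (Nat.factorial (a - y.1) : ℂ))) *
        ((p 1 * w 1) ^ (y.2.1 : ℕ) / (Nat.factorial y.2.1 : ℂ) *
          ((p 0 * w 0) ^ (b - y.2.1) / (Nat.factorial (b - y.2.1) : ℂ))) *
        ((q 0 * w 0) ^ (y.2.2 : ℕ) / (Nat.factorial y.2.2 : ℂ) *
          ((q 1 * w 1) ^ (c - y.2.2) / (Nat.factorial (c - y.2.2) : ℂ))) := by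
    rw [e1, e2, e3, add_pow_div_factorial, add_pow_div_factorial, add_pow_div_factorial,
      Finset.sum_range, Finset.sum_range, Finset.sum_range, Fintype.sum_prod_type, mul_assoc,
      Finset.sum_mul]
    refine Finset.sum_congr rfl fun k _ => ?_
    rw [Fintype.sum_prod_type, Finset.sum_mul_sum, Finset.mul_sum]
    refine Finset.sum_congr rfl fun s _ => ?_
    rw [Finset.mul_sum]
    exact Finset.sum_congr rfl fun t _ => (mul_assoc _ _ _).symm
  rw [e4]
  symm
  -- The three binomial sums are indexed by the exponents `k` of `p₁q₀`, `s` of `p₁w₁` and `t` of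
  -- `q₀w₀`. The image records the resulting exponents of `p₀`, `q₀`, `w₀`, with `k` as Racah's
  -- summation index.
  refine Finset.sum_of_injOn (fun y => (⟨2 * j₁ - y.1 - y.2.1, by omega⟩,
    ⟨y.1 + y.2.2, by omega⟩, ⟨b - y.2.1 + y.2.2, by omega⟩, ⟨y.1, by omega⟩)) ?_ ?_ ?_ ?_
  · rintro ⟨k, s, t⟩ _ ⟨k', s', t'⟩ _ h
    simp only [Prod.mk.injEq, Fin.mk.injEq] at h
    simp only [Prod.mk.injEq, Fin.ext_iff]
    omega
  · simp
  -- Outside the image some factorial in Racah's term has a negative argument, where `invFact` is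
  -- `0`.
  · rintro ⟨a₁, a₂, A, k⟩ - hx
    by_contra hne
    refine hx ?_
    simp only [ite_eq_right_iff, not_forall] at hne
    obtain ⟨hm, hne⟩ := hne
    have hr := (mul_ne_zero_iff.1 hne).1
    simp only [racahTerm, ne_eq, Complex.ofReal_eq_zero, mul_eq_zero, not_or] at hr
    obtain ⟨-, ⟨⟨⟨⟨h1, h2⟩, h3⟩, h4⟩, h5⟩, h6⟩ := hr
    have h2 := nonneg_of_invFact_ne_zero h2
    have h3 := nonneg_of_invFact_ne_zero h3
    have h4 := nonneg_of_invFact_ne_zero h4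
    have h5 := nonneg_of_invFact_ne_zero h5
    have h6 := nonneg_of_invFact_ne_zero h6
    simp only [order] at hm h2 h3 h4 h5 h6
    refine ⟨(⟨k, by omega⟩, ⟨2 * j₁ - a₁ - k, by omega⟩, ⟨a₂ - k, by omega⟩), by simp, ?_⟩
    simp only [Prod.mk.injEq, Fin.ext_iff]
    refine ⟨?_, ?_, ?_, ?_⟩
    · omega
    · omega
    · omega
    · trivial
  · rintro ⟨k, s, t⟩ -
    have hk := k.2
    have hs := s.2
    have ht := t.2
    rw [if_pos (by simp only [order]; omega)]
    have h2 : (j₁ : ℤ) + j₂ - J - ((k : ℕ) : ℤ) = ((a - k : ℕ) : ℤ) := by omega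
    have h3 : (j₁ : ℤ) - order j₁ ⟨2 * j₁ - k - s, by omega⟩ - ((k : ℕ) : ℤ) = ((s : ℕ) : ℤ) := by
      simp only [order]; omega
    have h4 : (j₂ : ℤ) + order j₂ ⟨k + t, by omega⟩ - ((k : ℕ) : ℤ) = ((t : ℕ) : ℤ) := by
      simp only [order]; omega
    have h5 : (J : ℤ) - j₂ + order j₁ ⟨2 * j₁ - k - s, by omega⟩ + ((k : ℕ) : ℤ) =
        ((b - s : ℕ) : ℤ) := by
      simp only [order]; omega
    have h6 : (J : ℤ) - j₁ - order j₂ ⟨k + t, by omega⟩ + ((k : ℕ) : ℤ) =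
        ((c - t : ℕ) : ℤ) := by
      simp only [order]; omega
    have n1 : 2 * j₁ - (k : ℕ) - s = (a - k) + (b - s) := by omega
    have n2 : 2 * j₁ - ((a - (k : ℕ)) + (b - s)) = k + s := by omega
    have n3 : 2 * j₂ - ((k : ℕ) + t) = (a - k) + (c - t) := by omega
    have n4 : 2 * J - (b - (s : ℕ) + t) = s + (c - t) := by omega
    simp only [racahTerm, h2, h3, h4, h5, h6, invFact_natCast]
    simp only [n1, n2, n3, n4, pow_add, mul_pow, neg_pow (p 1 * q 0)]
    push_cast
    ring

/-! ### Covariance of the Clebsch–Gordan coefficients -/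

/-- The tensor product of two vectors. -/
def tensorVec {m n K : Type} [Mul K] (x : m → K) (y : n → K) : m × n → K :=
  fun i => x i.1 * y i.2

theorem kronecker_mulVec_tensorVec {m n m' n' K : Type} [Fintype m'] [Fintype n'] [CommSemiring K]
    (A : Matrix m m' K) (B : Matrix n n' K) (x : m' → K) (y : n' → K) :
    (A ⊗ₖ B) *ᵥ tensorVec x y = tensorVec (A *ᵥ x) (B *ᵥ y) := by
  funext i
  simp only [mulVec, dotProduct, tensorVec, Fintype.sum_prod_type, Finset.sum_mul_sum]
  exact Finset.sum_congr rfl fun _ _ => Finset.sum_congr rfl fun _ _ => mul_mul_mul_comm _ _ _ _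

theorem eq_zero_of_tensorVec_monoVec {j₁ j₂ : ℕ} {c : Ord j₁ × Ord j₂ → ℂ}
    (h : ∀ p q, tensorVec (monoVec j₁ p) (monoVec j₂ q) ⬝ᵥ c = 0) : c = 0 := by
  have h1 (q) : (fun a₁ => ∑ a₂, c (a₁, a₂) * monoVec j₂ q a₂) = 0 :=
    eq_zero_of_monoVec fun p => by
      rw [← h p q]
      simp only [dotProduct, tensorVec, Fintype.sum_prod_type, Finset.sum_mul]
      exact Finset.sum_congr rfl fun _ _ => Finset.sum_congr rfl fun _ _ => by ring
  funext ⟨a₁, a₂⟩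
  have h2 : (fun a₂ => c (a₁, a₂)) = 0 := eq_zero_of_monoVec fun q => congrFun (h1 q) a₁
  exact congrFun h2 a₂

/-- The Clebsch–Gordan coefficients as a matrix. -/
def cgMatrix (j₁ j₂ J : ℕ) : Matrix (Ord j₁ × Ord j₂) (Ord J) ℂ :=
  fun a A => (clebschGordan j₁ (order j₁ a.1) j₂ (order j₂ a.2) J (order J A) : ℂ)

/-- The square roots depending on the orders cancel against those of the three monomial vectors;
what remains is `sum_racahTerm`. The constant is irrelevant for covariance: only the shape of the
form matters. -/
theorem cgMatrix_generating {j₁ j₂ J a b c : ℕ} (ha : a + J = j₁ + j₂) (hb : b + j₂ = j₁ + J)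
    (hc : c + j₁ = j₂ + J) : ∃ C : ℂ, ∀ p q w : Fin 2 → ℂ,
    tensorVec (monoVec j₁ p) (monoVec j₂ q) ⬝ᵥ cgMatrix j₁ j₂ J *ᵥ monoVec J w =
      C * ((p 0 * q 1 - p 1 * q 0) ^ a * (p ⬝ᵥ w) ^ b * (q ⬝ᵥ w) ^ c) := by
  refine ⟨(Real.sqrt ((2 * J + 1) *
        (intFact ((J : ℤ) + j₁ - j₂) * intFact ((J : ℤ) - j₁ + j₂) * intFact ((j₁ : ℤ) + j₂ - J)) /
        intFact ((j₁ : ℤ) + j₂ + J + 1)) : ℂ) /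
    ((Nat.factorial a : ℂ) * (Nat.factorial b : ℂ) * (Nat.factorial c : ℂ)), fun p q w => ?_⟩
  have key := sum_racahTerm ha hb hc p q w
  rw [div_mul_eq_mul_div, mul_div_assoc, show ((p 0 * q 1 - p 1 * q 0) ^ a * (p ⬝ᵥ w) ^ b *
      (q ⬝ᵥ w) ^ c) / ((Nat.factorial a : ℂ) * (Nat.factorial b : ℂ) * (Nat.factorial c : ℂ)) =
      ((p 0 * q 1 - p 1 * q 0) ^ a / (Nat.factorial a : ℂ)) *
      ((p ⬝ᵥ w) ^ b / (Nat.factorial b : ℂ)) * ((q ⬝ᵥ w) ^ c / (Nat.factorial c : ℂ)) by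
      rw [div_mul_div_comm, div_mul_div_comm], ← key]
  simp only [Fintype.sum_prod_type, Finset.mul_sum, dotProduct, mulVec, tensorVec]
  refine Finset.sum_congr rfl fun a₁ _ => Finset.sum_congr rfl fun a₂ _ =>
    Finset.sum_congr rfl fun A _ => ?_
  by_cases hm : order j₁ a₁ + order j₂ a₂ = order J A
  · have hcond : order j₁ a₁ + order j₂ a₂ = order J A ∧ J ≤ j₁ + j₂ ∧ j₁ ≤ j₂ + J ∧
      j₂ ≤ j₁ + J := ⟨hm, by omega, by omega, by omega⟩
    simp only [if_pos hm, cgMatrix, clebschGordan, if_pos hcond]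
    rw [← Finset.mul_sum, ← Finset.sum_mul]
    have h0 : ∑ k : Fin (j₁ + j₂ + 1),
        (racahTerm j₁ (order j₁ a₁) j₂ (order j₂ a₂) J k : ℂ) =
        ((∑ k ∈ Finset.range (j₁ + j₂ + 1),
          racahTerm j₁ (order j₁ a₁) j₂ (order j₂ a₂) J k : ℝ) : ℂ) := by
      rw [Finset.sum_range, Complex.ofReal_sum]
    rw [h0]
    change _ * _ * (((_ * _ * (∑ k ∈ Finset.range (j₁ + j₂ + 1),
          racahTerm j₁ (order j₁ a₁) j₂ (order j₂ a₂) J k) : ℝ) : ℂ) * _) = _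
    rw [intFact_add_order, intFact_sub_order, intFact_add_order, intFact_sub_order,
      intFact_add_order, intFact_sub_order]
    rw [show (Nat.factorial A * Nat.factorial (2 * J - A) * Nat.factorial (2 * j₁ - a₁) *
        Nat.factorial a₁ * Nat.factorial (2 * j₂ - a₂) * Nat.factorial a₂ : ℝ) =
        (Nat.factorial a₁ * Nat.factorial (2 * j₁ - a₁)) *
        (Nat.factorial a₂ * Nat.factorial (2 * j₂ - a₂)) *
        (Nat.factorial A * Nat.factorial (2 * J - A)) by ring,
      Real.sqrt_mul (by positivity), Real.sqrt_mul (by positivity)]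
    simp only [Complex.ofReal_mul, monoVec]
    have h1 := sqrt_factorial_ne_zero a₁ (2 * j₁ - a₁)
    have h2 := sqrt_factorial_ne_zero a₂ (2 * j₂ - a₂)
    have h3 := sqrt_factorial_ne_zero A (2 * J - A)
    generalize (Real.sqrt ((Nat.factorial a₁ : ℝ) * (Nat.factorial (2 * j₁ - a₁) : ℝ)) : ℂ) = s₁ at *
    generalize (Real.sqrt ((Nat.factorial a₂ : ℝ) * (Nat.factorial (2 * j₂ - a₂) : ℝ)) : ℂ) = s₂ at *
    generalize (Real.sqrt ((Nat.factorial A : ℝ) * (Nat.factorial (2 * J - A) : ℝ)) : ℂ) = s₃ at *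
    generalize ((∑ k ∈ Finset.range (j₁ + j₂ + 1),
          racahTerm j₁ (order j₁ a₁) j₂ (order j₂ a₂) J k : ℝ) : ℂ) = S
    generalize p 0 ^ (a₁ : ℕ) * p 1 ^ (2 * j₁ - a₁) = P
    generalize q 0 ^ (a₂ : ℕ) * q 1 ^ (2 * j₂ - a₂) = Q
    generalize w 0 ^ (A : ℕ) * w 1 ^ (2 * J - A) = W
    clear key h0 hcond
    field_simp
  · have hcond : ¬(order j₁ a₁ + order j₂ a₂ = order J A ∧ J ≤ j₁ + j₂ ∧ j₁ ≤ j₂ + J ∧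
      j₂ ≤ j₁ + J) := fun h => hm h.1
    simp [if_neg hm, cgMatrix, clebschGordan, if_neg hcond]

/-- Letting `g` act on `w` is the same as letting `gᵀ` act on `p` and `q` in the two dot products,
and this changes the bracket only by the factor `det g = 1`. Outside the triangle inequalities the
matrix vanishes. -/
theorem cgMatrix_covariant {g : Matrix (Fin 2) (Fin 2) ℂ} (hg : g.det = 1) (j₁ j₂ J : ℕ) :
    (symPow j₁ g ⊗ₖ symPow j₂ g) * cgMatrix j₁ j₂ J = cgMatrix j₁ j₂ J * symPow J g := by
  by_cases hcond : J ≤ j₁ + j₂ ∧ j₁ ≤ j₂ + J ∧ j₂ ≤ j₁ + J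
  · obtain ⟨C, hC⟩ := cgMatrix_generating (j₁ := j₁) (j₂ := j₂) (J := J) (a := j₁ + j₂ - J)
      (b := j₁ + J - j₂) (c := j₂ + J - j₁) (by omega) (by omega) (by omega)
    refine matrix_ext_of_monoVec fun w => sub_eq_zero.1 (eq_zero_of_tensorVec_monoVec fun p q => ?_)
    rw [dotProduct_sub, sub_eq_zero, ← mulVec_mulVec, ← mulVec_mulVec, ← monoVec_mulVec, hC,
      dotProduct_mulVec, ← mulVec_transpose, ← kroneckerMap_transpose, kronecker_mulVec_tensorVec,
      ← symPow_transpose, ← symPow_transpose, ← monoVec_mulVec, ← monoVec_mulVec, hC,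
      mulVec_transpose, mulVec_transpose, ← dotProduct_mulVec, ← dotProduct_mulVec]
    have h1 : (p ᵥ* g) 0 * (q ᵥ* g) 1 - (p ᵥ* g) 1 * (q ᵥ* g) 0 =
        (p 0 * q 1 - p 1 * q 0) * g.det := by
      simp only [vecMul, dotProduct, Fin.sum_univ_two, det_fin_two]
      ring
    rw [h1, hg, mul_one]
  · have h0 : cgMatrix j₁ j₂ J = 0 := by
      ext a A
      have : ¬(order j₁ a.1 + order j₂ a.2 = order J A ∧ J ≤ j₁ + j₂ ∧ j₁ ≤ j₂ + J ∧
        j₂ ≤ j₁ + J) := fun h => hcond h.2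
      simp [cgMatrix, clebschGordan, if_neg this]
    rw [h0, Matrix.mul_zero, Matrix.zero_mul]

/-! ### Real bases -/

/-- The change of basis from complex to real spherical harmonics. -/
def realBasisMatrix (l : ℕ) : Matrix (Ord l) (Ord l) ℂ :=
  fun a b => realBasis (order l a) (order l b)

theorem order_rev (l : ℕ) (a : Ord l) : order l a.rev = -order l a := by
  simp only [order, Fin.val_rev]
  omega

theorem order_inj {l : ℕ} {a b : Ord l} : order l a = order l b ↔ a = b := by
  simp only [order, Fin.ext_iff]
  omega

theorem neg_one_pow_order (l : ℕ) (a : Ord l) :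
    (-1 : ℂ) ^ (order l a).natAbs = (-1) ^ l * (-1) ^ (a : ℕ) := by
  rw [← pow_add]
  refine neg_one_pow_congr ?_
  simp only [order]
  grind

/-- The entry of the change of basis in column `a` of row `a`. -/
def realBasisDiag (a : ℤ) : ℂ :=
  if a = 0 then 1 else if 0 < a then (-1) ^ a.natAbs / (Real.sqrt 2 : ℂ)
  else Complex.I / (Real.sqrt 2 : ℂ)

/-- The entry of the change of basis in column `-a` of row `a ≠ 0`; it is `0` if `a = 0`. -/
def realBasisAnti (a : ℤ) : ℂ :=
  if a = 0 then 0 else if 0 < a then 1 / (Real.sqrt 2 : ℂ)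
  else -(Complex.I * (-1) ^ a.natAbs) / (Real.sqrt 2 : ℂ)

theorem realBasis_eq (a b : ℤ) : realBasis a b =
    (if b = a then realBasisDiag a else 0) + (if b = -a then realBasisAnti a else 0) := by
  unfold realBasis realBasisDiag realBasisAnti
  rcases lt_trichotomy a 0 with ha | rfl | ha
  · by_cases h1 : b = a
    · have h2 : ¬ a = -a := by omega
      simp [h1, h2, ha.ne, ha.not_gt]
    · by_cases h2 : b = -a
      · have h3 : ¬ -a = a := by omega
        simp [h2, h3, ha.ne, ha.not_gt]
      · simp [h1, h2, ha.ne]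
  · simp
  · by_cases h1 : b = a
    · have h2 : ¬ a = -a := by omega
      simp [h1, h2, ha.ne', ha]
    · by_cases h2 : b = -a
      · have h3 : ¬ -a = a := by omega
        simp [h2, h3, ha.ne', ha]
      · simp [h1, h2, ha.ne', ha]

theorem sqrt_two_mul_self : (Real.sqrt 2 : ℂ) * (Real.sqrt 2 : ℂ) = 2 := by
  have h := Real.mul_self_sqrt (show (0 : ℝ) ≤ 2 by norm_num)
  exact_mod_cast h

theorem neg_one_pow_mul_self (n : ℕ) : (-1 : ℂ) ^ n * (-1) ^ n = 1 := by
  rw [← mul_pow]; simp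

theorem star_realBasisDiag {a : ℤ} (ha : a ≠ 0) :
    star (realBasisDiag a) = (-1) ^ a.natAbs * realBasisAnti a := by
  have hs := neg_one_pow_mul_self a.natAbs
  rcases ha.lt_or_gt with h | h
  · simp only [realBasisDiag, realBasisAnti, if_neg ha, if_neg h.not_gt, star_div₀,
      Complex.star_def, Complex.conj_I, Complex.conj_ofReal]
    linear_combination (Complex.I / (Real.sqrt 2 : ℂ)) * hs
  · simp [realBasisDiag, realBasisAnti, ha, h, div_eq_mul_inv]

/-- The rows are fixed by the real structure `v_m ↦ (-1)^m conj v_{-m}`, the one that `symPow_rev`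
shows to be respected by `SU(2)`. -/
theorem star_realBasis (a b : ℤ) :
    star (realBasis a b) = (-1) ^ b.natAbs * realBasis a (-b) := by
  have hs := neg_one_pow_mul_self b.natAbs
  by_cases ha : a = 0
  · subst ha
    by_cases hb : b = 0
    · simp [realBasis, hb]
    · simp [realBasis, hb]
  have hd := star_realBasisDiag ha
  rw [realBasis_eq, realBasis_eq]
  by_cases h1 : b = a
  · subst h1
    have h2 : ¬ b = -b := by omega
    have h3 : ¬ -b = b := by omega
    simp [h2, h3, hd]
  · by_cases h2 : b = -a
    · subst h2
      have h3 : ¬ -a = a := by omega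
      have h4 : ¬ a = -a := by omega
      have hd' := congrArg star hd
      rw [star_star, star_mul', star_pow, star_neg, star_one] at hd'
      simp only [Int.natAbs_neg] at hs
      simp only [h3, h4, if_false, if_true, neg_neg, zero_add, add_zero, Int.natAbs_neg, hd',
        ← mul_assoc, hs, one_mul]
    · have h3 : ¬ -b = a := by omega
      have h4 : ¬ -b = -a := by omega
      simp [h1, h2, h3, h4]

theorem realBasisMatrix_apply (l : ℕ) (a b : Ord l) : realBasisMatrix l a b =
    (if b = a then realBasisDiag (order l a) else 0) +
      (if b = a.rev then realBasisAnti (order l a) else 0) := by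
  rw [realBasisMatrix, realBasis_eq, ← order_rev]
  simp only [order_inj]

/-- Row `a` is supported on the columns `a` and `a.rev`, so only the pairs `b = a` and `b = a.rev`
need computation. -/
theorem realBasisMatrix_mul_conjTranspose (l : ℕ) :
    realBasisMatrix l * (realBasisMatrix l)ᴴ = 1 := by
  ext a b
  simp only [mul_apply, conjTranspose_apply]
  simp only [realBasisMatrix_apply l a, add_mul, ite_mul, zero_mul, Finset.sum_add_distrib,
    Finset.sum_ite_eq', Finset.mem_univ, if_true]
  rw [realBasisMatrix_apply, realBasisMatrix_apply]
  have hs := neg_one_pow_mul_self (order l a).natAbs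
  have h2 := sqrt_two_mul_self
  have h2' : (Real.sqrt 2 : ℂ) ≠ 0 := fun h => by rw [h] at h2; norm_num at h2
  by_cases hab : a = b
  · subst hab
    by_cases h0 : order l a = 0
    · have hr : a.rev = a := by rw [← order_inj, order_rev, h0, neg_zero]
      simp [hr, h0, realBasisDiag, realBasisAnti]
    · have hr : ¬ a = a.rev := by rw [← order_inj, order_rev]; omega
      have hr' : ¬ a.rev = a := fun h => hr h.symm
      rcases lt_or_gt_of_ne h0 with h | h
      · simp [hr, hr', h0, h.not_gt, realBasisDiag, realBasisAnti]
        field_simp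
        linear_combination -(1 + ((-1 : ℂ) ^ (order l a).natAbs) ^ 2) * Complex.I_sq + hs - h2
      · simp [hr, hr', h0, h, realBasisDiag, realBasisAnti]
        field_simp
        linear_combination hs - h2
  · have hba : ¬ b = a := fun h => hab h.symm
    by_cases hr : a = b.rev
    · have hb : order l b = -order l a := by rw [hr, order_rev, neg_neg]
      have h0 : order l a ≠ 0 := fun h0 => hab (by rw [← order_inj, hb, h0, neg_zero])
      have h1 : a.rev = b := by rw [hr, Fin.rev_rev]
      have h3 : ¬ b = b.rev := fun h => hab (hr.trans h.symm)
      rcases lt_or_gt_of_ne h0 with h | h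
      · simp [← hr, h1, hab, hba, hb, h0, h, h.not_gt, realBasisDiag, realBasisAnti]
        field_simp
        linear_combination -Complex.I * hs
      · simp [← hr, h1, hab, hba, hb, h0, h, h.not_gt, realBasisDiag, realBasisAnti]
        field_simp
        linear_combination Complex.I * hs
    · have h1 : ¬ a.rev = b := fun h => hr (by rw [← h, Fin.rev_rev])
      simp [hab, hr, h1]

theorem realBasisMatrix_conjTranspose_mul (l : ℕ) :
    (realBasisMatrix l)ᴴ * realBasisMatrix l = 1 :=
  mul_eq_one_comm.1 (realBasisMatrix_mul_conjTranspose l)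

/-- The symmetric power of an element of `SU(2)` in the basis of real spherical harmonics. -/
def realSymPow (l : ℕ) (g : Matrix (Fin 2) (Fin 2) ℂ) : Matrix (Ord l) (Ord l) ℂ :=
  realBasisMatrix l * symPow l g * (realBasisMatrix l)ᴴ

theorem star_realBasisMatrix (l : ℕ) (a b : Ord l) :
    star (realBasisMatrix l a b) = (-1) ^ l * (-1) ^ (b : ℕ) * realBasisMatrix l a b.rev := by
  rw [realBasisMatrix, star_realBasis, neg_one_pow_order, realBasisMatrix, order_rev]

/-- Conjugation reverses the summation indices in all three factors, and every sign it creates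
occurs twice. -/
theorem star_realSymPow {g : Matrix (Fin 2) (Fin 2) ℂ}
    (h₀ : g 1 1 = star (g 0 0)) (h₁ : g 1 0 = -star (g 0 1)) (l : ℕ) (a b : Ord l) :
    star (realSymPow l g a b) = realSymPow l g a b := by
  simp only [realSymPow, mul_apply, conjTranspose_apply, star_sum, star_mul', star_star,
    symPow_rev h₀ h₁, Finset.sum_mul]
  refine (Equiv.sum_comp Fin.revPerm _).symm.trans (Finset.sum_congr rfl fun d _ => ?_)
  refine (Equiv.sum_comp Fin.revPerm _).symm.trans (Finset.sum_congr rfl fun c _ => ?_)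
  simp only [Fin.revPerm_apply]
  have hb : realBasisMatrix l b d.rev = (-1) ^ l * (-1) ^ (d : ℕ) * star (realBasisMatrix l b d) := by
    rw [star_realBasisMatrix]
    have h1 := neg_one_pow_mul_self l
    have h2 := neg_one_pow_mul_self (d : ℕ)
    linear_combination (-realBasisMatrix l b d.rev * (-1) ^ (d : ℕ) * (-1) ^ (d : ℕ)) * h1 -
      realBasisMatrix l b d.rev * h2
  have hr (e : Ord l) : (-1 : ℂ) ^ (e.rev : ℕ) = (-1) ^ (e : ℕ) := by
    refine neg_one_pow_congr ?_
    rw [Fin.val_rev]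
    grind
  rw [star_realBasisMatrix, hb, hr, hr, Fin.rev_rev, Fin.rev_rev]
  have h1 := neg_one_pow_mul_self l
  have h2 := neg_one_pow_mul_self (d : ℕ)
  have h3 := neg_one_pow_mul_self (c : ℕ)
  generalize (-1 : ℂ) ^ l = x at *
  generalize (-1 : ℂ) ^ (d : ℕ) = y at *
  generalize (-1 : ℂ) ^ (c : ℕ) = z at *
  linear_combination (realBasisMatrix l a c * symPow l g c d * star (realBasisMatrix l b d)) *
    (y * y * z * z * h1 + z * z * h2 + h3)

/-! ### Orthogonal representations carried by the spherical harmonics -/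

/-- The Clebsch–Gordan coefficients in real bases, as a matrix. -/
def realCgMatrix (j₁ j₂ J : ℕ) : Matrix (Ord j₁ × Ord j₂) (Ord J) ℝ :=
  fun a A => realClebschGordan j₁ a.1 j₂ a.2 J A

/-- The matrices `D_l` describe the action of `R` on real spherical harmonics. -/
structure IsWigner (R : Matrix (Fin 3) (Fin 3) ℝ) (D : ∀ l, Matrix (Ord l) (Ord l) ℝ) : Prop where
  transpose_mul : ∀ l, (D l)ᵀ * D l = 1
  harmonic : ∀ l x, realHarmonic l (R *ᵥ x) = D l *ᵥ realHarmonic l x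
  clebschGordan : ∀ j₁ j₂ J, (D j₁ ⊗ₖ D j₂) * realCgMatrix j₁ j₂ J = realCgMatrix j₁ j₂ J * D J

/-- Taking real parts commutes with multiplication by real matrices. Covariance of the real
coefficients therefore follows from the complex identity without knowing that the complex expression
is real. -/
theorem map_re_mul {m n k : Type} [Fintype n] (A : Matrix m n ℝ) (B : Matrix n k ℂ) :
    (A.map Complex.ofReal * B).map Complex.re = A * B.map Complex.re := by
  ext i j
  simp [mul_apply]

theorem map_re_mul' {m n k : Type} [Fintype n] (A : Matrix m n ℂ) (B : Matrix n k ℝ) :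
    (A * B.map Complex.ofReal).map Complex.re = A.map Complex.re * B := by
  ext i j
  simp [mul_apply]

theorem realHarmonic_eq (l : ℕ) (x : Vec3) (a : Ord l) :
    realHarmonic l x a = ((realBasisMatrix l *ᵥ complexHarmonicVec l x) a).re := rfl

theorem realCgMatrix_eq (j₁ j₂ J : ℕ) : realCgMatrix j₁ j₂ J =
    (Complex.I ^ (j₁ + j₂ + J) • ((realBasisMatrix j₁ ⊗ₖ realBasisMatrix j₂) * cgMatrix j₁ j₂ J *
      (realBasisMatrix J)ᴴ)).map Complex.re := by
  ext a A
  simp only [realCgMatrix, realClebschGordan, map_apply, Matrix.smul_apply, smul_eq_mul, mul_apply,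
    conjTranspose_apply, Fintype.sum_prod_type, Finset.sum_mul]
  congr 2
  rw [Finset.sum_comm_cycle]
  refine Finset.sum_congr rfl fun B _ => Finset.sum_congr rfl fun b₁ _ =>
    Finset.sum_congr rfl fun b₂ _ => ?_
  exact mul_right_comm _ _ _

/-- The hypothesis `h` says that `g` lifts `R` along the double cover, expressed on quadratic forms.
The matrices are the symmetric powers of `g` in the real basis. -/
theorem isWigner_of_cover {R : Matrix (Fin 3) (Fin 3) ℝ} {g : Matrix (Fin 2) (Fin 2) ℂ}
    (hg : g ∈ Matrix.specialUnitaryGroup (Fin 2) ℂ)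
    (h : ∀ x w, nullForm (R *ᵥ x) w = nullForm x (gᵀ *ᵥ w)) :
    ∃ D, IsWigner R D := by
  obtain ⟨hu, hdet⟩ := Matrix.mem_specialUnitaryGroup_iff.1 hg
  have hu1 : gᴴ * g = 1 := Matrix.mem_unitaryGroup_iff'.1 hu
  -- Inverse equals adjugate when the determinant is one; reading off entries gives the shape of
  -- `SU(2)` matrices required by `symPow_rev`.
  have hadj : gᴴ = g.adjugate := by
    have := mul_adjugate g
    rw [hdet, one_smul] at this
    rw [← Matrix.mul_one gᴴ, ← this, ← Matrix.mul_assoc, hu1, Matrix.one_mul]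
  rw [adjugate_fin_two] at hadj
  have h₀ : g 1 1 = star (g 0 0) := (congrFun (congrFun hadj 0) 0).symm
  have h₁ : g 1 0 = -star (g 0 1) := by
    have h2 : star (g 0 1) = -g 1 0 := congrFun (congrFun hadj 1) 0
    rw [h2, neg_neg]
  have hre (l : ℕ) : ((realSymPow l g).map Complex.re).map Complex.ofReal = realSymPow l g := by
    ext a b
    exact Complex.conj_eq_iff_re.1 (star_realSymPow h₀ h₁ l a b)
  have hB (l : ℕ) : realSymPow l g * realBasisMatrix l = realBasisMatrix l * symPow l g := by
    rw [realSymPow, Matrix.mul_assoc, realBasisMatrix_conjTranspose_mul, Matrix.mul_one]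
  have hB' (l : ℕ) : (realBasisMatrix l)ᴴ * realSymPow l g = symPow l g * (realBasisMatrix l)ᴴ := by
    rw [realSymPow, ← Matrix.mul_assoc, ← Matrix.mul_assoc, realBasisMatrix_conjTranspose_mul,
      Matrix.one_mul]
  refine ⟨fun l => (realSymPow l g).map Complex.re, ⟨fun l => ?_, fun l x => ?_, fun j₁ j₂ J => ?_⟩⟩
  · have h2 : (realSymPow l g)ᴴ * realSymPow l g = 1 := by
      rw [realSymPow, conjTranspose_mul, conjTranspose_mul, conjTranspose_conjTranspose,
        ← symPow_conjTranspose]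
      calc _ = realBasisMatrix l * (symPow l gᴴ * (((realBasisMatrix l)ᴴ * realBasisMatrix l) *
            symPow l g)) * (realBasisMatrix l)ᴴ := by simp only [Matrix.mul_assoc]
        _ = 1 := by
          rw [realBasisMatrix_conjTranspose_mul, Matrix.one_mul, ← symPow_mul, hu1, symPow_one,
            Matrix.mul_one, realBasisMatrix_mul_conjTranspose]
    have h3 : (realSymPow l g)ᴴ = (((realSymPow l g).map Complex.re)ᵀ).map Complex.ofReal := by
      rw [transpose_map, hre]
      ext a b
      exact star_realSymPow h₀ h₁ l b a
    rw [h3] at h2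
    have h4 := congrArg (fun M => M.map Complex.re) h2
    simp only [map_re_mul] at h4
    rw [h4]
    ext a b
    by_cases hab : a = b <;> simp [hab, one_apply]
  · funext a
    rw [realHarmonic_eq, complexHarmonicVec_mulVec (h x), mulVec_mulVec, ← hB, ← mulVec_mulVec]
    conv_lhs => rw [← hre l]
    simp [mulVec, dotProduct, realHarmonic_eq]
  · have hk : (realSymPow j₁ g).map Complex.re ⊗ₖ (realSymPow j₂ g).map Complex.re =
        (realSymPow j₁ g ⊗ₖ realSymPow j₂ g).map Complex.re := by
      conv_rhs => rw [← hre j₁, ← hre j₂]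
      ext a b
      simp
    have hk' : ((realSymPow j₁ g).map Complex.re ⊗ₖ (realSymPow j₂ g).map Complex.re).map
        Complex.ofReal = realSymPow j₁ g ⊗ₖ realSymPow j₂ g := by
      conv_rhs => rw [← hre j₁, ← hre j₂]
      ext a b
      simp
    rw [realCgMatrix_eq, ← map_re_mul, ← map_re_mul', hk', hre, Matrix.mul_smul, Matrix.smul_mul]
    congr 2
    calc _ = (realSymPow j₁ g ⊗ₖ realSymPow j₂ g) * (realBasisMatrix j₁ ⊗ₖ realBasisMatrix j₂) *
          cgMatrix j₁ j₂ J * (realBasisMatrix J)ᴴ := by simp only [Matrix.mul_assoc]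
      _ = (realBasisMatrix j₁ ⊗ₖ realBasisMatrix j₂) * ((symPow j₁ g ⊗ₖ symPow j₂ g) *
          cgMatrix j₁ j₂ J) * (realBasisMatrix J)ᴴ := by
        rw [← mul_kronecker_mul, hB, hB, mul_kronecker_mul]
        simp only [Matrix.mul_assoc]
      _ = _ := by
        rw [cgMatrix_covariant hdet, Matrix.mul_assoc _ _ (realSymPow J g), hB']
        simp only [Matrix.mul_assoc]

/-- This reduces the existence of the matrices to rotations about two coordinate axes. -/
theorem IsWigner.mul {R S : Matrix (Fin 3) (Fin 3) ℝ} {D E : ∀ l, Matrix (Ord l) (Ord l) ℝ}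
    (hD : IsWigner R D) (hE : IsWigner S E) : IsWigner (R * S) fun l => D l * E l where
  transpose_mul l := by
    rw [Matrix.transpose_mul, Matrix.mul_assoc, ← Matrix.mul_assoc _ (D l), hD.transpose_mul,
      Matrix.one_mul, hE.transpose_mul]
  harmonic l x := by
    rw [← mulVec_mulVec, hD.harmonic, hE.harmonic, mulVec_mulVec]
  clebschGordan j₁ j₂ J := by
    rw [mul_kronecker_mul, Matrix.mul_assoc, hE.clebschGordan, ← Matrix.mul_assoc,
      hD.clebschGordan, Matrix.mul_assoc]

/-! ### Euler angles -/

/-- The rotation about the third axis with cosine `c` and sine `s`. -/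
def rotZ (c s : ℝ) : Matrix (Fin 3) (Fin 3) ℝ := !![c, -s, 0; s, c, 0; 0, 0, 1]

/-- The rotation about the second axis with cosine `c` and sine `s`. -/
def rotY (c s : ℝ) : Matrix (Fin 3) (Fin 3) ℝ := !![c, 0, s; 0, 1, 0; -s, 0, c]

/-- A lift to `SU(2)` of the rotation by `θ` involves the angle `θ/2`. -/
theorem exists_half_angle {c s : ℝ} (h : c ^ 2 + s ^ 2 = 1) :
    ∃ a b : ℝ, a ^ 2 + b ^ 2 = 1 ∧ c = a ^ 2 - b ^ 2 ∧ s = 2 * (a * b) := by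
  have hz : ‖(⟨c, s⟩ : ℂ)‖ = 1 := by
    rw [Complex.norm_def, Complex.normSq_mk, ← sq, ← sq, h, Real.sqrt_one]
  have h0 : (⟨c, s⟩ : ℂ) ≠ 0 := fun h0 => by rw [h0, norm_zero] at hz; norm_num at hz
  have hc := Complex.cos_arg h0
  have hs := Complex.sin_arg (⟨c, s⟩ : ℂ)
  rw [hz, div_one] at hc hs
  set θ := Complex.arg ⟨c, s⟩
  refine ⟨Real.cos (θ / 2), Real.sin (θ / 2), Real.cos_sq_add_sin_sq _, ?_, ?_⟩
  · have := Real.cos_two_mul' (θ / 2)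
    rw [← this, mul_div_cancel₀ _ two_ne_zero, hc]
  · have := Real.sin_two_mul (θ / 2)
    rw [mul_comm (Real.cos _), ← mul_assoc, ← this, mul_div_cancel₀ _ two_ne_zero, hs]

theorem exists_isWigner_rotZ {c s : ℝ} (h : c ^ 2 + s ^ 2 = 1) : ∃ D, IsWigner (rotZ c s) D := by
  obtain ⟨a, b, hab, rfl, rfl⟩ := exists_half_angle h
  have hab' : (a : ℂ) ^ 2 + (b : ℂ) ^ 2 = 1 := by exact_mod_cast hab
  -- The lift is `diag(e^{iθ/2}, e^{-iθ/2})`.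
  refine isWigner_of_cover
    (g := !![(a : ℂ) + b * Complex.I, 0; 0, (a : ℂ) - b * Complex.I]) ?_ fun x w => ?_
  · rw [mem_specialUnitaryGroup_iff, mem_unitaryGroup_iff]
    refine ⟨?_, ?_⟩
    · ext i j
      fin_cases i <;> fin_cases j <;> simp [mul_apply, Fin.sum_univ_two, star_apply]
      · linear_combination hab' - (b : ℂ) ^ 2 * Complex.I_sq
      · linear_combination hab' - (b : ℂ) ^ 2 * Complex.I_sq
    · rw [det_fin_two_of]
      linear_combination hab' - (b : ℂ) ^ 2 * Complex.I_sq
  · simp [nullForm, rotZ, mulVec, dotProduct, Fin.sum_univ_three, Fin.sum_univ_two]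
    linear_combination (w 0 ^ 2 * (2 * a * b * x 1 + b ^ 2 * x 0 + b ^ 2 * Complex.I * x 1) / 2 +
      w 1 ^ 2 * (-(2 * a * b * x 1) - b ^ 2 * x 0 + b ^ 2 * Complex.I * x 1) / 2 +
      x 2 * w 0 * w 1 * b ^ 2) * Complex.I_sq - x 2 * w 0 * w 1 * hab'

theorem exists_isWigner_rotY {c s : ℝ} (h : c ^ 2 + s ^ 2 = 1) : ∃ D, IsWigner (rotY c s) D := by
  obtain ⟨a, b, hab, rfl, rfl⟩ := exists_half_angle h
  have hab' : (a : ℂ) ^ 2 + (b : ℂ) ^ 2 = 1 := by exact_mod_cast hab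
  refine isWigner_of_cover (g := !![(a : ℂ), -b; b, a]) ?_ fun x w => ?_
  · rw [mem_specialUnitaryGroup_iff, mem_unitaryGroup_iff]
    refine ⟨?_, ?_⟩
    · ext i j
      fin_cases i <;> fin_cases j <;> simp [mul_apply, Fin.sum_univ_two, star_apply]
      · linear_combination hab'
      · ring
      · ring
      · linear_combination hab'
    · rw [det_fin_two_of]
      linear_combination hab'
  · simp [nullForm, rotY, mulVec, dotProduct, Fin.sum_univ_three, Fin.sum_univ_two]
    linear_combination (Complex.I * x 1 / 2 * (w 0 ^ 2 + w 1 ^ 2)) * hab'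

theorem rotZ_mul_rotZ {c s : ℝ} (h : c ^ 2 + s ^ 2 = 1) : rotZ c s * rotZ c (-s) = 1 := by
  ext i j
  fin_cases i <;> fin_cases j <;> simp [rotZ, mul_apply, Fin.sum_univ_three] <;> linarith

theorem rotY_mul_rotY {c s : ℝ} (h : c ^ 2 + s ^ 2 = 1) : rotY c s * rotY c (-s) = 1 := by
  ext i j
  fin_cases i <;> fin_cases j <;> simp [rotY, mul_apply, Fin.sum_univ_three] <;> linarith

theorem rotZ_mem {c s : ℝ} (h : c ^ 2 + s ^ 2 = 1) :
    rotZ c s ∈ specialOrthogonalGroup (Fin 3) ℝ := by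
  rw [mem_specialOrthogonalGroup_iff, mem_orthogonalGroup_iff]
  refine ⟨?_, by simp [rotZ, det_fin_three]; linarith⟩
  rw [← rotZ_mul_rotZ h]
  congr 1
  ext i j
  fin_cases i <;> fin_cases j <;> simp [rotZ]

theorem rotY_mem {c s : ℝ} (h : c ^ 2 + s ^ 2 = 1) :
    rotY c s ∈ specialOrthogonalGroup (Fin 3) ℝ := by
  rw [mem_specialOrthogonalGroup_iff, mem_orthogonalGroup_iff]
  refine ⟨?_, by simp [rotY, det_fin_three]; linarith⟩
  rw [← rotY_mul_rotY h]
  congr 1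
  ext i j
  fin_cases i <;> fin_cases j <;> simp [rotY]

theorem eq_rotZ_of_fixes {S : Matrix (Fin 3) (Fin 3) ℝ}
    (hS : S ∈ specialOrthogonalGroup (Fin 3) ℝ) (h0 : S 0 2 = 0) (h1 : S 1 2 = 0)
    (h2 : S 2 2 = 1) : ∃ c s : ℝ, c ^ 2 + s ^ 2 = 1 ∧ S = rotZ c s := by
  obtain ⟨hO, hdet⟩ := mem_specialOrthogonalGroup_iff.1 hS
  have hO1 := (mem_orthogonalGroup_iff (Fin 3) ℝ).1 hO
  have hO2 := (mem_orthogonalGroup_iff' (Fin 3) ℝ).1 hO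
  have e22 := congrFun (congrFun hO1 2) 2
  have f00 := congrFun (congrFun hO2 0) 0
  have f11 := congrFun (congrFun hO2 1) 1
  simp [mul_apply, Fin.sum_univ_three, h2] at e22 f00 f11
  have h20 : S 2 0 = 0 := by nlinarith [sq_nonneg (S 2 0), sq_nonneg (S 2 1)]
  have h21 : S 2 1 = 0 := by nlinarith [sq_nonneg (S 2 0), sq_nonneg (S 2 1)]
  rw [det_fin_three] at hdet
  simp only [h0, h1, h2, h20, h21] at hdet f00 f11
  -- The expression is the sum of the squared norms of two unit columns minus twice the determinant,
  -- that is, `2 - 2`.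
  have hz : (S 0 0 - S 1 1) ^ 2 + (S 0 1 + S 1 0) ^ 2 = 0 := by nlinarith
  have ha : S 1 1 = S 0 0 := by nlinarith [sq_nonneg (S 0 0 - S 1 1), sq_nonneg (S 0 1 + S 1 0)]
  have hb : S 0 1 = -S 1 0 := by nlinarith [sq_nonneg (S 0 0 - S 1 1), sq_nonneg (S 0 1 + S 1 0)]
  refine ⟨S 0 0, S 1 0, by nlinarith, ?_⟩
  ext i j
  fin_cases i <;> fin_cases j <;> simp [rotZ, h0, h1, h2, h20, h21, ha, hb]

theorem exists_unit_direction (x y : ℝ) :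
    ∃ c s : ℝ, c ^ 2 + s ^ 2 = 1 ∧ x = Real.sqrt (x ^ 2 + y ^ 2) * c ∧
      y = Real.sqrt (x ^ 2 + y ^ 2) * s := by
  have hr := Real.sq_sqrt (show 0 ≤ x ^ 2 + y ^ 2 by positivity)
  by_cases h : Real.sqrt (x ^ 2 + y ^ 2) = 0
  · rw [h] at hr ⊢
    refine ⟨1, 0, by norm_num, ?_, ?_⟩ <;> nlinarith [sq_nonneg x, sq_nonneg y]
  · refine ⟨x / Real.sqrt (x ^ 2 + y ^ 2), y / Real.sqrt (x ^ 2 + y ^ 2), ?_, ?_, ?_⟩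
    · rw [div_pow, div_pow, ← add_div, hr, div_self]
      rw [← hr]
      exact pow_ne_zero 2 h
    · field_simp
    · field_simp

/-- Rotations about the third and second axes bring the third column of `R` back to the third basis
vector; what remains is a rotation about the third axis. -/
theorem exists_euler (R : Matrix (Fin 3) (Fin 3) ℝ)
    (hR : R ∈ specialOrthogonalGroup (Fin 3) ℝ) :
    ∃ c s c' s' c'' s'' : ℝ, c ^ 2 + s ^ 2 = 1 ∧ c' ^ 2 + s' ^ 2 = 1 ∧ c'' ^ 2 + s'' ^ 2 = 1 ∧
      R = rotZ c s * rotY c' s' * rotZ c'' s'' := by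
  obtain ⟨hO, hdet⟩ := mem_specialOrthogonalGroup_iff.1 hR
  have f22 := congrFun (congrFun ((mem_orthogonalGroup_iff' (Fin 3) ℝ).1 hO) 2) 2
  simp [mul_apply, Fin.sum_univ_three] at f22
  obtain ⟨c, s, hcs, hx, hy⟩ := exists_unit_direction (R 0 2) (R 1 2)
  have hr := Real.sq_sqrt (show 0 ≤ R 0 2 ^ 2 + R 1 2 ^ 2 by positivity)
  set ρ := Real.sqrt (R 0 2 ^ 2 + R 1 2 ^ 2)
  have hρ : R 2 2 ^ 2 + ρ ^ 2 = 1 := by rw [hr]; linarith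
  have hcs' : c ^ 2 + (-s) ^ 2 = 1 := by rw [neg_sq]; exact hcs
  have hρ' : R 2 2 ^ 2 + (-ρ) ^ 2 = 1 := by rw [neg_sq]; exact hρ
  -- `rotZ c (-s)` moves the third column to `(ρ, 0, R 2 2)`, a unit vector, and `rotY (R 2 2) (-ρ)`
  -- moves that to `(0, 0, 1)`.
  have hS : rotY (R 2 2) (-ρ) * (rotZ c (-s) * R) ∈ specialOrthogonalGroup (Fin 3) ℝ :=
    mul_mem (rotY_mem hρ') (mul_mem (rotZ_mem hcs') hR)
  obtain ⟨c'', s'', h'', hS'⟩ := eq_rotZ_of_fixes hS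
    (by simp [rotY, rotZ, mul_apply, Fin.sum_univ_three, vecMul, dotProduct]
        linear_combination R 2 2 * c * hx + R 2 2 * s * hy + R 2 2 * ρ * hcs)
    (by simp [rotY, rotZ, mul_apply, Fin.sum_univ_three, vecMul, dotProduct]
        linear_combination -s * hx + c * hy)
    (by simp [rotY, rotZ, mul_apply, Fin.sum_univ_three, vecMul, dotProduct]
        linear_combination ρ * c * hx + ρ * s * hy + ρ ^ 2 * hcs + hρ)
  refine ⟨c, s, R 2 2, ρ, c'', s'', hcs, hρ, h'', ?_⟩
  rw [← hS', Matrix.mul_assoc, ← Matrix.mul_assoc (rotY (R 2 2) ρ), rotY_mul_rotY hρ,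
    Matrix.one_mul, ← Matrix.mul_assoc, rotZ_mul_rotZ hcs, Matrix.one_mul]

theorem exists_isWigner (R : SO3) : ∃ D, IsWigner R.1 D := by
  obtain ⟨c, s, c', s', c'', s'', h, h', h'', hR⟩ := exists_euler R.1 R.2
  obtain ⟨D, hD⟩ := exists_isWigner_rotZ h
  obtain ⟨D', hD'⟩ := exists_isWigner_rotY h'
  obtain ⟨D'', hD''⟩ := exists_isWigner_rotZ h''
  rw [hR]
  exact ⟨_, (hD.mul hD').mul hD''⟩

/-! ### Degrees zero and one -/

theorem eq_zero_of_ord_zero (a : Ord 0) : a = 0 := Subsingleton.elim (α := Fin 1) a 0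

theorem realHarmonic_zero (x : Vec3) (a : Ord 0) :
    realHarmonic 0 x a = Real.sqrt (1 / (4 * Real.pi)) := by
  have ha := eq_zero_of_ord_zero a
  subst ha
  rw [realHarmonic, Fin.sum_univ_one]
  norm_num [realBasis, complexHarmonic, order, intFact]

theorem complexHarmonic_one_zero (x : Vec3) :
    complexHarmonic 1 0 x = (Real.sqrt (3 / (4 * Real.pi)) : ℂ) * x 2 := by
  simp [complexHarmonic, intFact, Finset.sum_range_succ]
  norm_num

theorem complexHarmonic_one_one (x : Vec3) :
    complexHarmonic 1 1 x = (Real.sqrt (3 / (4 * Real.pi)) : ℂ) * (Real.sqrt 2 : ℂ) *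
      (-((x 0 : ℂ) + Complex.I * x 1) / 2) := by
  rw [← Complex.ofReal_mul, ← Real.sqrt_mul (by positivity)]
  simp [complexHarmonic, intFact, Finset.sum_range_succ]
  norm_num

theorem complexHarmonic_one_neg_one (x : Vec3) :
    complexHarmonic 1 (-1) x = (Real.sqrt (3 / (4 * Real.pi)) : ℂ) * (Real.sqrt 2 : ℂ) *
      (((x 0 : ℂ) - Complex.I * x 1) / 2) := by
  rw [← Complex.ofReal_mul, ← Real.sqrt_mul (by positivity)]
  simp [complexHarmonic, intFact, Finset.sum_range_succ]
  norm_num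

theorem realHarmonic_one (x : Vec3) (i : Fin 3) :
    realHarmonic 1 x (Model.cart i) = Real.sqrt (3 / (4 * Real.pi)) * x i := by
  have h2 := sqrt_two_mul_self
  have h2' : (Real.sqrt 2 : ℂ) ≠ 0 := fun h => by rw [h] at h2; norm_num at h2
  have key : ∑ b : Ord 1, realBasis (order 1 (Model.cart i)) (order 1 b) *
      complexHarmonic 1 (order 1 b) x = ((Real.sqrt (3 / (4 * Real.pi)) * x i : ℝ) : ℂ) := by
    have e0 : order 1 0 = -1 := rfl
    have e1 : order 1 1 = 0 := rfl
    have e2 : order 1 2 = 1 := rfl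
    rw [Fin.sum_univ_three, e0, e1, e2, complexHarmonic_one_neg_one, complexHarmonic_one_zero,
      complexHarmonic_one_one]
    generalize Real.sqrt (3 / (4 * Real.pi)) = κ
    fin_cases i
    · simp [Model.cart, e2, realBasis]
      field_simp
      ring
    · simp [Model.cart, e0, realBasis]
      field_simp
      linear_combination (-(2 : ℂ) * κ * x 1) * Complex.I_sq
    · simp [Model.cart, e1, realBasis]
  rw [realHarmonic, key, Complex.ofReal_re]

/-- The harmonic of degree `0` is a nonzero constant, so covariance leaves no choice. -/
theorem IsWigner.zero_eq {R : Matrix (Fin 3) (Fin 3) ℝ} {D : ∀ l, Matrix (Ord l) (Ord l) ℝ}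
    (h : IsWigner R D) : D 0 = 1 := by
  have h0 := congrFun (h.harmonic 0 0) 0
  have hπ : Real.sqrt (1 / (4 * Real.pi)) ≠ 0 := (Real.sqrt_pos.2 (by positivity)).ne'
  simp only [mulVec, dotProduct, realHarmonic_zero] at h0
  rw [Fin.sum_univ_one] at h0
  ext a b
  have ha := eq_zero_of_ord_zero a
  have hb := eq_zero_of_ord_zero b
  subst ha hb
  rw [one_apply_eq]
  exact (mul_right_cancel₀ hπ (by rw [one_mul]; exact h0)).symm

theorem cart_bijective : Function.Bijective Model.cart := by decide

/-- Up to a nonzero factor, `Y_1` in the order `cart` is the identity map, so covariance at the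
basis vectors reads off `R`. This is what turns features of degree one into vectors. -/
theorem IsWigner.one_apply_cart {R : Matrix (Fin 3) (Fin 3) ℝ}
    {D : ∀ l, Matrix (Ord l) (Ord l) ℝ} (h : IsWigner R D) (i j : Fin 3) :
    D 1 (Model.cart i) (Model.cart j) = R i j := by
  have h0 := congrFun (h.harmonic 1 (Pi.single j 1)) (Model.cart i)
  have hπ : Real.sqrt (3 / (4 * Real.pi)) ≠ 0 := (Real.sqrt_pos.2 (by positivity)).ne'
  have h1 : ∑ k, D 1 (Model.cart i) (Model.cart k) *
      realHarmonic 1 (Pi.single j 1) (Model.cart k) =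
      (D 1 *ᵥ realHarmonic 1 (Pi.single j 1)) (Model.cart i) :=
    cart_bijective.sum_comp fun b => D 1 (Model.cart i) b * realHarmonic 1 (Pi.single j 1) b
  rw [← h1, realHarmonic_one, mulVec_single_one, col_apply] at h0
  simp only [realHarmonic_one, Pi.single_apply, mul_ite, mul_one, mul_zero, Finset.sum_ite_eq',
    Finset.mem_univ, if_true] at h0
  exact (mul_left_cancel₀ hπ (by rw [h0, mul_comm])).symm

/-! ### Uniqueness of the projection to `SO(3)` -/

/-- Let `t` be the trace. From `Pᵀ = -adj P` the sum of the principal `2 × 2` minors is `-t`, so `tr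
(P²) = t² + 2t`. The squares of the entries of `P - Pᵀ` give `tr (P²) ≤ tr (Pᵀ P) = 3`, hence `(t +
3)(t - 1) ≤ 0`. -/
theorem trace_le_one {P : Matrix (Fin 3) (Fin 3) ℝ} (hP : P ∈ orthogonalGroup (Fin 3) ℝ)
    (hd : P.det = -1) : P.trace ≤ 1 := by
  have h1 : Pᵀ * P = 1 := (mem_orthogonalGroup_iff' (Fin 3) ℝ).1 hP
  have hadj : Pᵀ = -P.adjugate := by
    have h2 := mul_adjugate P
    rw [hd] at h2
    have h3 : Pᵀ * (P * P.adjugate) = P.adjugate := by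
      rw [← Matrix.mul_assoc, h1, Matrix.one_mul]
    rw [← h3, h2, neg_one_smul, Matrix.mul_neg, Matrix.mul_one, neg_neg]
  have e00 := congrFun (congrFun hadj 0) 0
  have e11 := congrFun (congrFun hadj 1) 1
  have e22 := congrFun (congrFun hadj 2) 2
  have f00 := congrFun (congrFun h1 0) 0
  have f11 := congrFun (congrFun h1 1) 1
  have f22 := congrFun (congrFun h1 2) 2
  rw [adjugate_fin_three] at e00 e11 e22
  simp [mul_apply, Fin.sum_univ_three] at e00 e11 e22 f00 f11 f22
  rw [trace_fin_three]
  nlinarith [sq_nonneg (P 0 1 - P 1 0), sq_nonneg (P 0 2 - P 2 0), sq_nonneg (P 1 2 - P 2 1)]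

theorem apply_le_one {P : Matrix (Fin 3) (Fin 3) ℝ} (hP : P ∈ orthogonalGroup (Fin 3) ℝ)
    (i : Fin 3) : P i i ≤ 1 := by
  have h := congrFun (congrFun ((mem_orthogonalGroup_iff (Fin 3) ℝ).1 hP) i) i
  rw [mul_apply, one_apply_eq] at h
  have h2 : P i i * P i i ≤ ∑ j, P i j * Pᵀ j i :=
    Finset.single_le_sum (f := fun j => P i j * Pᵀ j i) (fun j _ => mul_self_nonneg (P i j))
      (Finset.mem_univ i)
  nlinarith

theorem trace_mul_diagonal (P : Matrix (Fin 3) (Fin 3) ℝ) (σ : Fin 3 → ℝ) :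
    (P * diagonal σ).trace = P 0 0 * σ 0 + P 1 1 * σ 1 + P 2 2 * σ 2 := by
  simp [trace_fin_three, mul_diagonal]

/-- For `d = 1` the diagonal entries are at most one. For `d = -1` summation by parts writes the
defect as `(σ₀-σ₁)(1-P₀₀) + (σ₁-σ₂)((1-P₀₀)+(1-P₁₁)) + σ₂(1 - tr P)`, a sum of nonnegative terms. -/
theorem trace_mul_diagonal_le {P : Matrix (Fin 3) (Fin 3) ℝ} {d : ℝ} {σ : Fin 3 → ℝ}
    (hP : P ∈ orthogonalGroup (Fin 3) ℝ) (hd : P.det = d) (hd' : d = 1 ∨ d = -1)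
    (hσ : Antitone σ) (h0 : ∀ i, 0 ≤ σ i) :
    (P * diagonal σ).trace ≤ σ 0 + σ 1 + d * σ 2 := by
  have h01 : σ 1 ≤ σ 0 := hσ (by decide)
  have h12 : σ 2 ≤ σ 1 := hσ (by decide)
  have h2 := h0 2
  have p0 := apply_le_one hP 0
  have p1 := apply_le_one hP 1
  have p2 := apply_le_one hP 2
  rw [trace_mul_diagonal]
  rcases hd' with rfl | rfl
  · nlinarith [mul_nonneg (h0 0) (sub_nonneg.2 p0), mul_nonneg (h0 1) (sub_nonneg.2 p1),
      mul_nonneg (h0 2) (sub_nonneg.2 p2)]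
  · have ht := trace_le_one hP hd
    rw [trace_fin_three] at ht
    nlinarith [mul_nonneg (sub_nonneg.2 h01) (sub_nonneg.2 p0),
      mul_nonneg (sub_nonneg.2 h12) (add_nonneg (sub_nonneg.2 p0) (sub_nonneg.2 p1)),
      mul_nonneg h2 (sub_nonneg.2 ht)]

/-- In case of equality the gap `σ 2 < σ 1` forces `P 0 0 = P 1 1 = 1`. Rows and columns have unit
length, so the off-diagonal entries vanish, and the last entry is the determinant. No positivity of
`σ 2` is needed. -/
theorem eq_diagonal_of_trace_mul_diagonal_eq {P : Matrix (Fin 3) (Fin 3) ℝ} {d : ℝ}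
    {σ : Fin 3 → ℝ} (hP : P ∈ orthogonalGroup (Fin 3) ℝ) (hd : P.det = d)
    (hd' : d = 1 ∨ d = -1) (hσ : Antitone σ) (h0 : ∀ i, 0 ≤ σ i) (hlt : σ 2 < σ 1)
    (h : (P * diagonal σ).trace = σ 0 + σ 1 + d * σ 2) : P = diagonal ![1, 1, d] := by
  have h01 : σ 1 ≤ σ 0 := hσ (by decide)
  have h2 := h0 2
  have p0 := apply_le_one hP 0
  have p1 := apply_le_one hP 1
  have p2 := apply_le_one hP 2
  have hsum : (σ 1 - σ 2) * ((1 - P 0 0) + (1 - P 1 1)) ≤ 0 := by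
    rw [trace_mul_diagonal] at h
    rcases hd' with rfl | rfl
    · nlinarith [mul_nonneg (sub_nonneg.2 h01) (sub_nonneg.2 p0),
        mul_nonneg h2 (sub_nonneg.2 p0), mul_nonneg h2 (sub_nonneg.2 p1),
        mul_nonneg h2 (sub_nonneg.2 p2)]
    · have ht := trace_le_one hP hd
      rw [trace_fin_three] at ht
      nlinarith [mul_nonneg (sub_nonneg.2 h01) (sub_nonneg.2 p0),
        mul_nonneg h2 (sub_nonneg.2 ht)]
  have hle := nonpos_of_mul_nonpos_right hsum (sub_pos.2 hlt)
  have q0 : P 0 0 = 1 := by linarith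
  have q1 : P 1 1 = 1 := by linarith
  have r0 := congrFun (congrFun ((mem_orthogonalGroup_iff (Fin 3) ℝ).1 hP) 0) 0
  have r1 := congrFun (congrFun ((mem_orthogonalGroup_iff (Fin 3) ℝ).1 hP) 1) 1
  have c0 := congrFun (congrFun ((mem_orthogonalGroup_iff' (Fin 3) ℝ).1 hP) 0) 0
  have c1 := congrFun (congrFun ((mem_orthogonalGroup_iff' (Fin 3) ℝ).1 hP) 1) 1
  simp [mul_apply, Fin.sum_univ_three, q0, q1] at r0 r1 c0 c1
  obtain ⟨z01, z02⟩ : P 0 1 = 0 ∧ P 0 2 = 0 := mul_self_add_mul_self_eq_zero.1 (by linarith)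
  obtain ⟨z10, z12⟩ : P 1 0 = 0 ∧ P 1 2 = 0 := mul_self_add_mul_self_eq_zero.1 (by linarith)
  have z20 : P 2 0 = 0 :=
    (mul_self_add_mul_self_eq_zero.1 (by linarith : P 1 0 * P 1 0 + P 2 0 * P 2 0 = 0)).2
  have z21 : P 2 1 = 0 :=
    (mul_self_add_mul_self_eq_zero.1 (by linarith : P 0 1 * P 0 1 + P 2 1 * P 2 1 = 0)).2
  have q2 : P 2 2 = d := by
    rw [det_fin_three] at hd
    simpa [q0, q1, z01, z02, z10, z12, z20, z21] using hd
  ext i j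
  fin_cases i <;> fin_cases j <;> simp [q0, q1, q2, z01, z02, z10, z12, z20, z21]

theorem transpose_mem_orthogonalGroup {U : Matrix (Fin 3) (Fin 3) ℝ}
    (hU : U ∈ orthogonalGroup (Fin 3) ℝ) : Uᵀ ∈ orthogonalGroup (Fin 3) ℝ := by
  rw [mem_orthogonalGroup_iff, transpose_transpose]
  exact (mem_orthogonalGroup_iff' (Fin 3) ℝ).1 hU

theorem det_eq_one_or {U : Matrix (Fin 3) (Fin 3) ℝ} (hU : U ∈ orthogonalGroup (Fin 3) ℝ) :
    U.det = 1 ∨ U.det = -1 := by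
  have h := congrArg det ((mem_orthogonalGroup_iff (Fin 3) ℝ).1 hU)
  rw [det_mul, det_transpose, det_one] at h
  exact mul_self_eq_one_iff.1 h

/-- For a singular value decomposition `A = U diag(σ) Vᵀ`, `tr (Sᵀ A) = tr (Vᵀ Sᵀ U diag(σ))`. -/
theorem IsSVD.trace_transpose_mul {A U V : Matrix (Fin 3) (Fin 3) ℝ} {σ : Fin 3 → ℝ}
    (h : IsSVD A U V σ) (S : Matrix (Fin 3) (Fin 3) ℝ) :
    (Sᵀ * A).trace = (Vᵀ * Sᵀ * U * diagonal σ).trace := by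
  rw [h.eq, ← Matrix.mul_assoc, trace_mul_comm]
  simp only [Matrix.mul_assoc]

theorem IsSVD.signedProduct_eq {A U V : Matrix (Fin 3) (Fin 3) ℝ} {σ : Fin 3 → ℝ}
    (h : IsSVD A U V σ) : signedProduct U V = U * diagonal ![1, 1, (U * Vᵀ).det] * Vᵀ := by
  have hs : Real.sign (U * Vᵀ).det = (U * Vᵀ).det := by
    rcases det_eq_one_or (mul_mem h.left_mem (transpose_mem_orthogonalGroup h.right_mem))
      with h | h <;> rw [h] <;> norm_num [Real.sign]
  rw [signedProduct, hs]

theorem IsSVD.trace_signedProduct {A U V : Matrix (Fin 3) (Fin 3) ℝ} {σ : Fin 3 → ℝ}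
    (h : IsSVD A U V σ) : ((signedProduct U V)ᵀ * A).trace = σ 0 + σ 1 + (U * Vᵀ).det * σ 2 := by
  rw [h.trace_transpose_mul, h.signedProduct_eq]
  have hU := (mem_orthogonalGroup_iff' (Fin 3) ℝ).1 h.left_mem
  have hV := (mem_orthogonalGroup_iff' (Fin 3) ℝ).1 h.right_mem
  rw [transpose_mul, transpose_mul, transpose_transpose, diagonal_transpose]
  have : Vᵀ * (V * (diagonal ![1, 1, (U * Vᵀ).det] * Uᵀ)) * U =
      diagonal ![1, 1, (U * Vᵀ).det] := by
    calc _ = (Vᵀ * V) * diagonal ![1, 1, (U * Vᵀ).det] * (Uᵀ * U) := by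
          simp only [Matrix.mul_assoc]
      _ = _ := by
        erw [hU, hV]
        rw [Matrix.mul_one, Matrix.one_mul]
  rw [this, trace_mul_diagonal]
  simp

/-- The signed product solves the orthogonal Procrustes problem on `SO(3)`: for `S` a rotation, `Vᵀ
Sᵀ U` is orthogonal with determinant `det (U Vᵀ)`, and the trace bound applies. -/
theorem IsSVD.trace_le {A U V : Matrix (Fin 3) (Fin 3) ℝ} {σ : Fin 3 → ℝ}
    (h : IsSVD A U V σ) {S : Matrix (Fin 3) (Fin 3) ℝ}
    (hS : S ∈ specialOrthogonalGroup (Fin 3) ℝ) :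
    (Sᵀ * A).trace ≤ ((signedProduct U V)ᵀ * A).trace := by
  obtain ⟨hSO, hSd⟩ := mem_specialOrthogonalGroup_iff.1 hS
  rw [h.trace_signedProduct, h.trace_transpose_mul]
  refine trace_mul_diagonal_le
    (mul_mem (mul_mem (transpose_mem_orthogonalGroup h.right_mem)
      (transpose_mem_orthogonalGroup hSO)) h.left_mem) ?_
    (det_eq_one_or (mul_mem h.left_mem (transpose_mem_orthogonalGroup h.right_mem)))
    h.antitone h.nonneg
  simp [det_mul, hSd, mul_comm]

theorem IsSVD.eq_signedProduct {A U V : Matrix (Fin 3) (Fin 3) ℝ} {σ : Fin 3 → ℝ}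
    (h : IsSVD A U V σ) (hlt : σ 2 < σ 1) {S : Matrix (Fin 3) (Fin 3) ℝ}
    (hS : S ∈ specialOrthogonalGroup (Fin 3) ℝ)
    (heq : (Sᵀ * A).trace = ((signedProduct U V)ᵀ * A).trace) : S = signedProduct U V := by
  obtain ⟨hSO, hSd⟩ := mem_specialOrthogonalGroup_iff.1 hS
  rw [h.trace_signedProduct, h.trace_transpose_mul] at heq
  have key := eq_diagonal_of_trace_mul_diagonal_eq
    (mul_mem (mul_mem (transpose_mem_orthogonalGroup h.right_mem)
      (transpose_mem_orthogonalGroup hSO)) h.left_mem)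
    (by simp [det_mul, hSd, mul_comm])
    (det_eq_one_or (mul_mem h.left_mem (transpose_mem_orthogonalGroup h.right_mem)))
    h.antitone h.nonneg hlt heq
  have hU := (mem_orthogonalGroup_iff (Fin 3) ℝ).1 h.left_mem
  have hV := (mem_orthogonalGroup_iff (Fin 3) ℝ).1 h.right_mem
  have key' := congrArg transpose key
  rw [transpose_mul, transpose_mul, transpose_transpose, transpose_transpose,
    diagonal_transpose] at key'
  rw [h.signedProduct_eq, ← key']
  calc S = 1 * S * 1 := by rw [Matrix.one_mul, Matrix.mul_one]
    _ = (U * Uᵀ) * S * (V * Vᵀ) := by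
      erw [hU, hV]
    _ = _ := by simp only [Matrix.mul_assoc]

theorem exists_isSVD_svdProj (A : Matrix (Fin 3) (Fin 3) ℝ) :
    ∃ U V σ, IsSVD A U V σ ∧ (svdProj A).1 = signedProduct U V :=
  (exists_svdProj A).choose_spec

/-- If the smallest singular value is distinct, then all singular value decompositions have the
same signed product. -/
theorem svdProj_eq {A U V : Matrix (Fin 3) (Fin 3) ℝ} {σ : Fin 3 → ℝ}
    (hA : SmallestSingularValueDistinct A) (h : IsSVD A U V σ) :
    (svdProj A).1 = signedProduct U V := by
  obtain ⟨U₀, V₀, σ₀, h₀, hlt⟩ := hA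
  -- Both signed products maximize the same functional, hence attain the same value; uniqueness is
  -- applied to the decomposition for which the gap is known.
  have key {U V : Matrix (Fin 3) (Fin 3) ℝ} {σ : Fin 3 → ℝ} (h : IsSVD A U V σ) :
      signedProduct U V = signedProduct U₀ V₀ :=
    h₀.eq_signedProduct hlt (signedProduct_mem h.left_mem h.right_mem)
      (le_antisymm (h₀.trace_le (signedProduct_mem h.left_mem h.right_mem))
        (h.trace_le (signedProduct_mem h₀.left_mem h₀.right_mem)))
  obtain ⟨U₁, V₁, σ₁, h₁, e₁⟩ := exists_isSVD_svdProj A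
  rw [e₁, key h₁, key h]

/-- The projection to `SO(3)` is bi-equivariant. -/
theorem svdProj_mul_mul {A : Matrix (Fin 3) (Fin 3) ℝ} (hA : SmallestSingularValueDistinct A)
    (R S : SO3) : svdProj (R.1 * A * S.1ᵀ) = R * svdProj A * S⁻¹ := by
  obtain ⟨U, V, σ, h, e⟩ := exists_isSVD_svdProj (R.1 * A * S.1ᵀ)
  obtain ⟨hR, hRd⟩ := mem_specialOrthogonalGroup_iff.1 R.2
  obtain ⟨hS, hSd⟩ := mem_specialOrthogonalGroup_iff.1 S.2
  have hR' : R.1ᵀ * R.1 = 1 := (mem_orthogonalGroup_iff' (Fin 3) ℝ).1 hR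
  have hR'' : R.1 * R.1ᵀ = 1 := (mem_orthogonalGroup_iff (Fin 3) ℝ).1 hR
  have hS' : S.1ᵀ * S.1 = 1 := (mem_orthogonalGroup_iff' (Fin 3) ℝ).1 hS
  have hS'' : S.1 * S.1ᵀ = 1 := (mem_orthogonalGroup_iff (Fin 3) ℝ).1 hS
  -- The decomposition is pulled back to `A`, so the gap is needed for `A` only; the sign is
  -- unaffected because `R` and `S` have determinant one.
  have h1 : IsSVD A (R.1ᵀ * U) (S.1ᵀ * V) σ := by
    refine ⟨mul_mem (transpose_mem_orthogonalGroup hR) h.left_mem,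
      mul_mem (transpose_mem_orthogonalGroup hS) h.right_mem, h.antitone, h.nonneg, ?_⟩
    calc A = (R.1ᵀ * R.1) * A * (S.1ᵀ * S.1) := by
          rw [hR', hS', Matrix.one_mul, Matrix.mul_one]
      _ = R.1ᵀ * (R.1 * A * S.1ᵀ) * S.1 := by simp only [Matrix.mul_assoc]
      _ = _ := by
        rw [h.eq, transpose_mul, transpose_transpose]
        simp only [Matrix.mul_assoc]
  refine Subtype.ext ?_
  change _ = R.1 * (svdProj A).1 * S.1ᵀ
  rw [e, svdProj_eq hA h1, h1.signedProduct_eq, h.signedProduct_eq]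
  have hd : (R.1ᵀ * U * (S.1ᵀ * V)ᵀ).det = (U * Vᵀ).det := by
    simp [det_mul, hRd, hSd]
  rw [hd, transpose_mul, transpose_transpose]
  calc _ = (R.1 * R.1ᵀ) * U * diagonal ![1, 1, (U * Vᵀ).det] * Vᵀ * (S.1 * S.1ᵀ) := by
        rw [hR'', hS'', Matrix.one_mul, Matrix.mul_one]
    _ = _ := by
      simp only [Matrix.mul_assoc]

/-! ### Equivariance of the layers -/

section Layers

variable {I : Type} {ix : I → Type} [∀ i, Fintype (ix i)]

/-- The action of matrices `ρ_i` on the channels of a feature. -/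
def rotFeature {τ : FeatType I} (ρ : ∀ i, Matrix (ix i) (ix i) ℝ) (F : Feature ix τ) :
    Feature ix τ :=
  fun i a => ρ i *ᵥ F i a

theorem rotFeature_apply {τ : FeatType I} (ρ : ∀ i, Matrix (ix i) (ix i) ℝ) (F : Feature ix τ)
    (i : I) (a : Fin (τ.ch i)) : rotFeature ρ F i a = ρ i *ᵥ F i a := rfl

theorem mixChannels_rotFeature {σ τ : FeatType I} (ρ : ∀ i, Matrix (ix i) (ix i) ℝ)
    (W : ChannelWeights σ τ) (F : Feature ix σ) :
    mixChannels W (rotFeature ρ F) = rotFeature ρ (mixChannels W F) := by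
  funext i a m
  simp only [mixChannels, rotFeature, mulVec, dotProduct, Finset.mul_sum]
  rw [Finset.sum_comm]
  exact Finset.sum_congr rfl fun _ _ => Finset.sum_congr rfl fun _ _ => mul_left_comm _ _ _

theorem applyKernels_rotFeature {σ τ : FeatType I} {ρ : ∀ i, Matrix (ix i) (ix i) ℝ}
    {K K' : Kernels ix σ τ} (hK : ∀ o a i b, K' o a i b * ρ i = ρ o * K o a i b)
    (F : Feature ix σ) : applyKernels K' (rotFeature ρ F) = rotFeature ρ (applyKernels K F) := by
  funext o a
  simp only [applyKernels, rotFeature, mulVec_sum, mulVec_mulVec, hK]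

theorem mulVec_dotProduct_mulVec {n : Type} [Fintype n] [DecidableEq n] {A : Matrix n n ℝ}
    (hA : Aᵀ * A = 1) (x y : n → ℝ) : (A *ᵥ x) ⬝ᵥ (A *ᵥ y) = x ⬝ᵥ y := by
  rw [dotProduct_mulVec, ← mulVec_transpose, mulVec_mulVec, hA, one_mulVec]

theorem featInner_rotFeature [∀ i, DecidableEq (ix i)] {τ : FeatType I}
    {ρ : ∀ i, Matrix (ix i) (ix i) ℝ} (hρ : ∀ i, (ρ i)ᵀ * ρ i = 1) (F G : Feature ix τ) :
    featInner (rotFeature ρ F) (rotFeature ρ G) = featInner F G := by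
  simp only [featInner, rotFeature, mulVec_dotProduct_mulVec (hρ _)]

theorem rotFeature_add {τ : FeatType I} (ρ : ∀ i, Matrix (ix i) (ix i) ℝ) (F G : Feature ix τ) :
    rotFeature ρ (F + G) = rotFeature ρ F + rotFeature ρ G := by
  funext i a
  exact mulVec_add _ _ _

theorem rotFeature_sum_smul {τ : FeatType I} (ρ : ∀ i, Matrix (ix i) (ix i) ℝ) {n : ℕ}
    (s : Finset (Fin n)) (c : Fin n → ℝ) (F : Fin n → Feature ix τ) :
    rotFeature ρ (∑ v ∈ s, c v • F v) = ∑ v ∈ s, c v • rotFeature ρ (F v) := by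
  funext i a
  simp only [rotFeature, Finset.sum_apply, Pi.smul_apply, mulVec_sum, mulVec_smul]

/-- Queries and keys are transformed by the same orthogonal matrices, so the attention weights do
not change and the layer is a combination of equivariant terms with invariant coefficients. -/
theorem transformerLayer_rotFeature [∀ i, DecidableEq (ix i)] {n : ℕ} {σ κ τ : FeatType I}
    {ρ : ∀ i, Matrix (ix i) (ix i) ℝ} (hρ : ∀ i, (ρ i)ᵀ * ρ i = 1)
    (N : Fin n → Finset (Fin n)) (W : ChannelWeights σ τ) (WQ : ChannelWeights σ κ)
    {𝒲K 𝒲K' : Fin n → Fin n → Kernels ix σ κ} {𝒲V 𝒲V' : Fin n → Fin n → Kernels ix σ τ}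
    (hK : ∀ u v o a i b, 𝒲K' u v o a i b * ρ i = ρ o * 𝒲K u v o a i b)
    (hV : ∀ u v o a i b, 𝒲V' u v o a i b * ρ i = ρ o * 𝒲V u v o a i b)
    (f : Fin n → Feature ix σ) :
    transformerLayer N W WQ 𝒲K' 𝒲V' (fun u => rotFeature ρ (f u)) =
      fun u => rotFeature ρ (transformerLayer N W WQ 𝒲K 𝒲V f u) := by
  funext u
  simp only [transformerLayer, attention, mixChannels_rotFeature,
    applyKernels_rotFeature (hK _ _), applyKernels_rotFeature (hV _ _), featInner_rotFeature hρ,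
    rotFeature_add, rotFeature_sum_smul]

theorem norm_mulVec {n : Type} [Fintype n] [DecidableEq n] {A : Matrix n n ℝ} (hA : Aᵀ * A = 1)
    (x : n → ℝ) : ‖WithLp.toLp 2 (A *ᵥ x)‖ = ‖WithLp.toLp 2 x‖ := by
  have h := mulVec_dotProduct_mulVec hA x x
  simp only [dotProduct, ← sq] at h
  simp only [EuclideanSpace.norm_eq, Real.norm_eq_abs, sq_abs, h]

theorem eluVec_mulVec {n : Type} [Fintype n] [DecidableEq n] {A : Matrix n n ℝ}
    (hA : Aᵀ * A = 1) (x y : n → ℝ) : eluVec (A *ᵥ x) (A *ᵥ y) = A *ᵥ eluVec x y := by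
  simp only [eluVec, mulVec_dotProduct_mulVec hA, norm_mulVec hA, ← mulVec_smul]
  split_ifs
  · rfl
  · rw [mulVec_sub, mulVec_smul]

theorem eluLayer_rotFeature [∀ i, DecidableEq (ix i)] {n : ℕ} {τ : FeatType I}
    {ρ : ∀ i, Matrix (ix i) (ix i) ℝ} (hρ : ∀ i, (ρ i)ᵀ * ρ i = 1) (Wμ Wν : ChannelWeights τ τ)
    (f : Fin n → Feature ix τ) :
    eluLayer Wμ Wν (fun u => rotFeature ρ (f u)) =
      fun u => rotFeature ρ (eluLayer Wμ Wν f u) := by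
  funext u i a
  simp only [eluLayer, mixChannels_rotFeature]
  exact eluVec_mulVec (hρ i) _ _

theorem rotFeature_constFeature [DecidableEq I] [∀ i, DecidableEq (ix i)]
    {ρ : ∀ i, Matrix (ix i) (ix i) ℝ} {o : I} (ho : ρ o = 1) {c : ℕ} (b : Fin c → ℝ) :
    rotFeature ρ (constFeature ix o b) = constFeature ix o b := by
  funext i a
  by_cases hi : i = o
  · subst hi
    rw [rotFeature, ho, one_mulVec]
  · have h0 : (FeatType.single o c).ch i = 0 := if_neg hi
    exact absurd h0 (Fin.pos a).ne'

end Layers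

/-! ### Equivariance of the kernels -/

theorem SO3.transpose_mul_self (R : SO3) : R.1ᵀ * R.1 = 1 :=
  (mem_orthogonalGroup_iff' (Fin 3) ℝ).1 (mem_specialOrthogonalGroup_iff.1 R.2).1

theorem len_mulVec (R : SO3) (x : Vec3) : len (R.1 *ᵥ x) = len x :=
  norm_mulVec R.transpose_mul_self x

theorem unitVec_mulVec (R : SO3) (x : Vec3) : unitVec (R.1 *ᵥ x) = R.1 *ᵥ unitVec x := by
  rw [unitVec, unitVec, len_mulVec, mulVec_smul]

/-- The summand of degree `J` of a kernel, without the radial function. -/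
def angularKernel (o i J : ℕ) (x : Vec3) : Matrix (Ord o) (Ord i) ℝ :=
  fun m₃ m₁ => (realCgMatrix i o J *ᵥ realHarmonic J (unitVec x)) (m₁, m₃)

theorem kernel3_eq (o i : ℕ) (φ : ℕ → ℝ → ℝ) (x : Vec3) :
    kernel3 o i φ x = ∑ J ∈ degrees o i, φ J (len x) • angularKernel o i J x := by
  ext m₃ m₁
  simp only [Matrix.sum_apply, Matrix.smul_apply, smul_eq_mul]
  rfl

/-- Each summand is a Kronecker product of angular kernels, so covariance for `ℝ⁶` follows factor by
factor. -/
theorem kernel6_eq (o i : ℕ × ℕ) (φ : ℕ → ℕ → ℝ → ℝ → ℝ) (z : Vec6) :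
    kernel6 o i φ z = ∑ J₁ ∈ degrees o.1 i.1, ∑ J₂ ∈ degrees o.2 i.2,
      φ J₁ J₂ (len z.1) (len z.2) •
        (angularKernel o.1 i.1 J₁ z.1 ⊗ₖ angularKernel o.2 i.2 J₂ z.2) := by
  ext m₃₄ m₁₂
  simp only [Matrix.sum_apply, Matrix.smul_apply, smul_eq_mul, kernel6]
  refine Finset.sum_congr rfl fun J₁ _ => Finset.sum_congr rfl fun J₂ _ => ?_
  congr 1
  change _ = angularKernel o.1 i.1 J₁ z.1 m₃₄.1 m₁₂.1 * angularKernel o.2 i.2 J₂ z.2 m₃₄.2 m₁₂.2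
  simp only [angularKernel, mulVec, dotProduct, Finset.sum_mul_sum]
  exact Finset.sum_congr rfl fun _ _ => Finset.sum_congr rfl fun _ _ => mul_mul_mul_comm _ _ _ _

section Equivariance

variable {R : SO3} {D : ∀ l, Matrix (Ord l) (Ord l) ℝ}

/-- Read as a matrix, a vector acted on by `D i ⊗ D o` becomes `D o * _ * (D i)ᵀ`; orthogonality of
`D i` moves the last factor across. The harmonics are covariant at every vector, so `x = 0` is no
exception. -/
theorem IsWigner.angularKernel_mul (h : IsWigner R.1 D) (o i J : ℕ) (x : Vec3) :
    angularKernel o i J (R.1 *ᵥ x) * D i = D o * angularKernel o i J x := by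
  have key : angularKernel o i J (R.1 *ᵥ x) = D o * angularKernel o i J x * (D i)ᵀ := by
    ext m₃ m₁
    rw [angularKernel, unitVec_mulVec, h.harmonic, mulVec_mulVec, ← h.clebschGordan,
      ← mulVec_mulVec]
    change ∑ p, (D i ⊗ₖ D o) (m₁, m₃) p *
      (realCgMatrix i o J *ᵥ realHarmonic J (unitVec x)) p = _
    simp only [Fintype.sum_prod_type, mul_apply,
      transpose_apply, Finset.sum_mul, kronecker_apply]
    refine Finset.sum_congr rfl fun n₁ _ => Finset.sum_congr rfl fun n₃ _ => ?_
    change _ = D o m₃ n₃ * (realCgMatrix i o J *ᵥ realHarmonic J (unitVec x)) (n₁, n₃) * D i m₁ n₁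
    ring
  rw [key, Matrix.mul_assoc, h.transpose_mul, Matrix.mul_one]

theorem IsWigner.kernel3_mul (h : IsWigner R.1 D) (o i : ℕ) (φ : ℕ → ℝ → ℝ) (x : Vec3) :
    kernel3 o i φ (R.1 *ᵥ x) * D i = D o * kernel3 o i φ x := by
  simp only [kernel3_eq, Matrix.sum_mul, Matrix.mul_sum, Matrix.smul_mul, Matrix.mul_smul,
    len_mulVec, h.angularKernel_mul]

/-- Only differences of points enter, so translations drop out; distances, and with them the
neighbourhoods, are unchanged. -/
theorem IsWigner.net3_eval (h : IsWigner R.1 D) (k : ℕ) {n : ℕ} {X X' : Cloud n}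
    (hX : ∀ u v, X' v - X' u = R.1 *ᵥ (X v - X u)) {σ τ : FeatType ℕ} (net : Net3 σ τ)
    (f : Fin n → Feature Ord σ) :
    net.eval k X' (fun u => rotFeature D (f u)) = fun u => rotFeature D (net.eval k X f u) := by
  have hd : (fun u v => dist3 (X' u) (X' v)) = fun u v => dist3 (X u) (X v) := by
    funext u v
    rw [dist3, dist3, hX, len_mulVec]
  induction net with
  | nil τ => rfl
  | attn L rest ih =>
    rw [Net3.eval, Net3.eval, ← ih]
    congr 1
    rw [Attn3.eval, Attn3.eval, hd]
    exact transformerLayer_rotFeature h.transpose_mul _ _ _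
      (fun u v o a i b => by rw [hX]; exact h.kernel3_mul _ _ _ _)
      (fun u v o a i b => by rw [hX]; exact h.kernel3_mul _ _ _ _) f
  | elu Wμ Wν rest ih =>
    rw [Net3.eval, Net3.eval, ← ih, eluLayer_rotFeature h.transpose_mul]

variable {S : SO3} {E : ∀ l, Matrix (Ord l) (Ord l) ℝ}

theorem IsWigner.kernel6_mul (h : IsWigner R.1 D) (h' : IsWigner S.1 E) (o i : ℕ × ℕ)
    (φ : ℕ → ℕ → ℝ → ℝ → ℝ) (z : Vec6) :
    kernel6 o i φ (R.1 *ᵥ z.1, S.1 *ᵥ z.2) * (D i.1 ⊗ₖ E i.2) =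
      (D o.1 ⊗ₖ E o.2) * kernel6 o i φ z := by
  simp only [kernel6_eq, Matrix.sum_mul, Matrix.mul_sum, Matrix.smul_mul, Matrix.mul_smul,
    len_mulVec, ← mul_kronecker_mul, h.angularKernel_mul, h'.angularKernel_mul]

theorem IsWigner.kronecker_transpose_mul (h : IsWigner R.1 D) (h' : IsWigner S.1 E)
    (i : ℕ × ℕ) : (D i.1 ⊗ₖ E i.2)ᵀ * (D i.1 ⊗ₖ E i.2) = 1 := by
  rw [← kroneckerMap_transpose, ← mul_kronecker_mul, h.transpose_mul, h'.transpose_mul,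
    one_kronecker_one]

theorem IsWigner.net6_eval (h : IsWigner R.1 D) (h' : IsWigner S.1 E) (k : ℕ) {n : ℕ}
    {Z Z' : Fin n → Vec6}
    (hZ : ∀ u v, Z' v - Z' u = (R.1 *ᵥ (Z v - Z u).1, S.1 *ᵥ (Z v - Z u).2))
    {σ τ : FeatType (ℕ × ℕ)} (net : Net6 σ τ) (f : Fin n → Feature Ord6 σ) :
    net.eval k Z' (fun u => rotFeature (fun i => D i.1 ⊗ₖ E i.2) (f u)) =
      fun u => rotFeature (fun i => D i.1 ⊗ₖ E i.2) (net.eval k Z f u) := by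
  have hd : (fun u v => dist6 (Z' u) (Z' v)) = fun u v => dist6 (Z u) (Z v) := by
    funext u v
    have h1 : (Z' u).1 - (Z' v).1 = R.1 *ᵥ ((Z u).1 - (Z v).1) := congrArg Prod.fst (hZ v u)
    have h2 : (Z' u).2 - (Z' v).2 = S.1 *ᵥ ((Z u).2 - (Z v).2) := congrArg Prod.snd (hZ v u)
    rw [dist6, dist6, h1, h2, len_mulVec, len_mulVec]
  induction net with
  | nil τ => rfl
  | attn L rest ih =>
    rw [Net6.eval, Net6.eval, ← ih]
    congr 1
    rw [Attn6.eval, Attn6.eval, hd]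
    exact transformerLayer_rotFeature (h.kronecker_transpose_mul h') _ _ _
      (fun u v o a i b => by rw [hZ]; exact h.kernel6_mul h' _ _ _ _)
      (fun u v o a i b => by rw [hZ]; exact h.kernel6_mul h' _ _ _ _) f
  | elu Wμ Wν rest ih =>
    rw [Net6.eval, Net6.eval, ← ih, eluLayer_rotFeature (h.kronecker_transpose_mul h')]

end Equivariance

/-! ### Equivariance of the model -/

theorem SE3.actCloud_sub {n : ℕ} (g : SE3) (X : Cloud n) (u v : Fin n) :
    g.actCloud X v - g.actCloud X u = g.rot.1 *ᵥ (X v - X u) := by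
  simp only [SE3.actCloud, SE3.act, mulVec_sub]
  abel

theorem sum_smul_act {n : ℕ} (g : SE3) (c : Fin n → ℝ) (hc : ∑ u, c u = 1) (X : Cloud n) :
    ∑ u, c u • g.act (X u) = g.act (∑ u, c u • X u) := by
  simp only [SE3.act, smul_add, Finset.sum_add_distrib, ← Finset.sum_smul, hc, one_smul,
    mulVec_sum, mulVec_smul]

/-- For `n = 0` the average is `0` and does not follow translations, hence the hypothesis `hn`. -/
theorem pool_act {n : ℕ} (hn : n ≠ 0) (g : SE3) (X : Cloud n) :
    pool (fun u => g.act (X u)) = g.act (pool X) := by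
  have hc : ∑ _u : Fin n, (n : ℝ)⁻¹ = 1 := by
    simp [hn]
  rw [pool, pool, Finset.smul_sum, Finset.smul_sum, sum_smul_act g _ hc]

theorem pool_mulVec {n : ℕ} {ι κ : Type} [Fintype κ] (A : Matrix ι κ ℝ) (x : Fin n → κ → ℝ) :
    pool (fun u => A *ᵥ x u) = A *ᵥ pool x := by
  rw [pool, pool, mulVec_smul, mulVec_sum]

namespace Model

variable (Φ : Model)

theorem sum_softmax {l n : ℕ} (hn : 0 < n) (F : Matrix (Fin l) (Fin n) ℝ) (a : Fin l) :
    ∑ u, softmax F a u = 1 := by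
  have : Nonempty (Fin n) := ⟨⟨0, hn⟩⟩
  simp only [softmax, ← Finset.sum_div]
  exact div_self (Finset.sum_pos (fun _ _ => Real.exp_pos _) Finset.univ_nonempty).ne'

theorem body_actCloud {g : SE3} {D : ∀ l, Matrix (Ord l) (Ord l) ℝ} (hD : IsWigner g.rot.1 D)
    {n : ℕ} (X : Cloud n) :
    Φ.body (g.actCloud X) = fun u => rotFeature D (Φ.body X u) := by
  rw [body, body, ← hD.net3_eval Φ.k3 (g.actCloud_sub X), rotFeature_constFeature hD.zero_eq]

/-- Only degree-`0` features pass between the clouds, and these are invariant, so two unrelated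
rotations cause no conflict. -/
theorem fuse_rotFeature {τ : FeatType ℕ} {D E : ∀ l, Matrix (Ord l) (Ord l) ℝ} (hD : D 0 = 1)
    (hE : E 0 = 1) {n m : ℕ} (f : Fin n → Feature Ord τ) (g : Fin m → Feature Ord τ) :
    fuse (fun u => rotFeature D (f u)) (fun v => rotFeature E (g v)) =
      fun u => rotFeature D (fuse f g u) := by
  funext u i
  cases i with
  | zero =>
    have h (F : Feature Ord τ) : rotFeature D F 0 = F 0 := by
      funext a
      rw [rotFeature, hD, one_mulVec]
    have h' (F : Feature Ord τ) : rotFeature E F 0 = F 0 := by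
      funext a
      rw [rotFeature, hE, one_mulVec]
    funext a
    rw [rotFeature, hD, one_mulVec]
    simp only [fuse, h, h']
  | succ p => rfl

theorem weights_actCloud (g₁ g₂ : SE3) {n m : ℕ} (X : Cloud n) (Y : Cloud m) :
    Φ.weights (g₁.actCloud X) (g₂.actCloud Y) = Φ.weights X Y := by
  obtain ⟨D, hD⟩ := exists_isWigner g₁.rot
  obtain ⟨E, hE⟩ := exists_isWigner g₂.rot
  funext l u
  rw [weights, weights, Φ.body_actCloud hD, Φ.body_actCloud hE,
    fuse_rotFeature hD.zero_eq hE.zero_eq, hD.net3_eval Φ.k3 (g₁.actCloud_sub X)]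
  dsimp only
  rw [rotFeature_apply, hD.zero_eq, one_mulVec]

/-- The softmax weights are invariant and sum to one, so each key point is an affine combination of
the cloud with fixed coefficients. -/
theorem keyPoints_actCloud (g₁ g₂ : SE3) {n m : ℕ} (hn : 0 < n) (X : Cloud n) (Y : Cloud m) :
    Φ.keyPoints (g₁.actCloud X) (g₂.actCloud Y) = g₁.actCloud (Φ.keyPoints X Y) := by
  funext a
  rw [keyPoints, weights_actCloud]
  exact sum_smul_act g₁ _ (sum_softmax hn _ a) X

theorem ΦS_actCloud {g₁ g₂ : SE3} {D E : ∀ l, Matrix (Ord l) (Ord l) ℝ}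
    (hD : IsWigner g₁.rot.1 D) (hE : IsWigner g₂.rot.1 E) {M N : ℕ} (hM : 0 < M) (hN : 0 < N)
    (X : Cloud M) (Y : Cloud N) :
    Φ.ΦS (g₁.actCloud X) (g₂.actCloud Y) =
      ⟨fun u => (g₁.act ((Φ.ΦS X Y).pos u).1, g₂.act ((Φ.ΦS X Y).pos u).2),
        fun u => rotFeature (fun i => D i.1 ⊗ₖ E i.2) ((Φ.ΦS X Y).feat u)⟩ := by
  have hρ : (fun i : ℕ × ℕ => D i.1 ⊗ₖ E i.2) (0, 0) = 1 := by
    simp only [hD.zero_eq, hE.zero_eq, one_kronecker_one]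
  simp only [ΦS, Φ.keyPoints_actCloud _ _ hM, Φ.keyPoints_actCloud _ _ hN]
  congr 1
  rw [← hD.net6_eval hE Φ.k6 (Z := fun u => (Φ.keyPoints X Y u, Φ.keyPoints Y X u))
    (Z' := fun u => (g₁.actCloud (Φ.keyPoints X Y) u, g₂.actCloud (Φ.keyPoints Y X) u))]
  · simp only [rotFeature_constFeature (ix := Ord6) (ρ := fun i => D i.1 ⊗ₖ E i.2) hρ Φ.bias6]
  · intro u v
    exact Prod.ext (g₁.actCloud_sub _ u v) (g₂.actCloud_sub _ u v)

variable {Φ}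

/-- Under `unvec`, with columns from the first factor, `D 1 ⊗ E 1` becomes left multiplication by
`S` and right multiplication by `Rᵀ`. -/
theorem rHat_rotFeature {R S : SO3} {D E : ∀ l, Matrix (Ord l) (Ord l) ℝ}
    (hD : IsWigner R.1 D) (hE : IsWigner S.1 E) {l : ℕ} (f : Field6 l Φ.out6)
    (pos : Fin l → Vec6) :
    Φ.rHat ⟨pos, fun u => rotFeature (fun i => D i.1 ⊗ₖ E i.2) (f.feat u)⟩ =
      S.1 * Φ.rHat f * R.1ᵀ := by
  ext i j
  have h := pool_mulVec (D 1 ⊗ₖ E 1) fun u => f.feat u (1, 1) Φ.chR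
  simp only [rHat, rotFeature, h, mul_apply, transpose_apply, Finset.sum_mul]
  simp only [mulVec, dotProduct, Fintype.sum_prod_type]
  rw [← cart_bijective.sum_comp]
  refine Finset.sum_congr rfl fun j' _ => ?_
  rw [← cart_bijective.sum_comp]
  refine Finset.sum_congr rfl fun i' _ => ?_
  rw [kronecker_apply, hD.one_apply_cart, hE.one_apply_cart]
  ring

theorem tX_rotFeature {R S : SO3} {D E : ∀ l, Matrix (Ord l) (Ord l) ℝ}
    (hD : IsWigner R.1 D) (hE : IsWigner S.1 E) {l : ℕ} (f : Field6 l Φ.out6)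
    (pos : Fin l → Vec6) :
    Φ.tX ⟨pos, fun u => rotFeature (fun i => D i.1 ⊗ₖ E i.2) (f.feat u)⟩ = R.1 *ᵥ Φ.tX f := by
  funext i
  have h := pool_mulVec (D 1 ⊗ₖ E 0) fun u => f.feat u (1, 0) Φ.chX
  simp only [tX, rotFeature, h]
  simp only [mulVec, dotProduct, Fintype.sum_prod_type]
  rw [← cart_bijective.sum_comp]
  refine Finset.sum_congr rfl fun j _ => ?_
  rw [Fin.sum_univ_one, kronecker_apply, hD.one_apply_cart, hE.zero_eq, one_apply_eq, mul_one]
  rfl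

theorem tY_rotFeature {R S : SO3} {D E : ∀ l, Matrix (Ord l) (Ord l) ℝ}
    (hD : IsWigner R.1 D) (hE : IsWigner S.1 E) {l : ℕ} (f : Field6 l Φ.out6)
    (pos : Fin l → Vec6) :
    Φ.tY ⟨pos, fun u => rotFeature (fun i => D i.1 ⊗ₖ E i.2) (f.feat u)⟩ = S.1 *ᵥ Φ.tY f := by
  funext i
  have h := pool_mulVec (D 0 ⊗ₖ E 1) fun u => f.feat u (0, 1) Φ.chY
  simp only [tY, rotFeature, h]
  simp only [mulVec, dotProduct, Fintype.sum_prod_type]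
  rw [Fin.sum_univ_one, ← cart_bijective.sum_comp]
  refine Finset.sum_congr rfl fun j _ => ?_
  rw [kronecker_apply, hE.one_apply_cart, hD.zero_eq, one_apply_eq, one_mul]
  rfl

/-- Without key points the average `r̂` is zero and all its singular values coincide. This supplies
the nonemptiness needed by `pool_act`. -/
theorem ne_zero_of_smallestSingularValueDistinct {l : ℕ} {f : Field6 l Φ.out6}
    (h : SmallestSingularValueDistinct (Φ.rHat f)) : l ≠ 0 := by
  rintro rfl
  obtain ⟨U, V, σ, hs, hlt⟩ := h
  have h0 : Φ.rHat f = 0 := by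
    ext i j
    simp [rHat, pool]
  have hU : Uᵀ * U = 1 := (mem_orthogonalGroup_iff' (Fin 3) ℝ).1 hs.left_mem
  have hV : Vᵀ * V = 1 := (mem_orthogonalGroup_iff' (Fin 3) ℝ).1 hs.right_mem
  have h1 : diagonal σ = 0 := by
    calc diagonal σ = (Uᵀ * U) * diagonal σ * (Vᵀ * V) := by
          rw [hU, hV, Matrix.one_mul, Matrix.mul_one]
      _ = Uᵀ * (U * diagonal σ * Vᵀ) * V := by simp only [Matrix.mul_assoc]
      _ = 0 := by rw [← hs.eq, h0, Matrix.mul_zero, Matrix.zero_mul]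
  have h2 (i) : σ i = 0 := by
    have := congrFun (congrFun h1 i) i
    rwa [diagonal_apply_eq] at this
  rw [h2, h2] at hlt
  exact lt_irrefl _ hlt

end Model

end

end BITR

theorem proposition2 (Φ : BITR.Model) {M N : ℕ} (hM : 0 < M) (hN : 0 < N)
    (X : BITR.Cloud M) (Y : BITR.Cloud N)
    (hσ : BITR.SmallestSingularValueDistinct (Φ.rHat (Φ.ΦS X Y)))
    (g₁ g₂ : BITR.SE3) :
    Φ.ΦP (Φ.ΦS (g₁.actCloud X) (g₂.actCloud Y)) = g₂ * Φ.ΦP (Φ.ΦS X Y) * g₁⁻¹ := by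
  obtain ⟨D, hD⟩ := BITR.exists_isWigner g₁.rot
  obtain ⟨E, hE⟩ := BITR.exists_isWigner g₂.rot
  have hL := BITR.Model.ne_zero_of_smallestSingularValueDistinct hσ
  have hrot : BITR.svdProj (g₂.rot.1 * Φ.rHat (Φ.ΦS X Y) * g₁.rot.1.transpose) =
      g₂.rot * BITR.svdProj (Φ.rHat (Φ.ΦS X Y)) * g₁.rot⁻¹ := BITR.svdProj_mul_mul hσ _ _
  rw [Φ.ΦS_actCloud hD hE hM hN]
  generalize Φ.ΦS X Y = f at *
  have hinv : (g₁.rot⁻¹).1.mulVec (g₁.rot.1.mulVec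
      (BITR.pool (fun u => (f.pos u).1) + Φ.tX f)) =
      BITR.pool (fun u => (f.pos u).1) + Φ.tX f := by
    rw [Matrix.mulVec_mulVec]
    exact (congrArg (fun A => Matrix.mulVec A _) g₁.rot.transpose_mul_self).trans
      (Matrix.one_mulVec _)
  simp only [BITR.Model.ΦP, BITR.Model.rHat_rotFeature hD hE, hrot,
    BITR.Model.tX_rotFeature hD hE, BITR.Model.tY_rotFeature hD hE,
    BITR.pool_act hL, BITR.SE3.mul_def, BITR.SE3.inv_def, BITR.SE3.mk.injEq, true_and]
  generalize BITR.svdProj (Φ.rHat f) = r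
  -- The mean transforms as a point and `t_X` as a vector, so their sum transforms as a point;
  -- multiplication by `g₁⁻¹` then cancels both the rotation and the translation of `g₁`.
  have hact : g₁.act (BITR.pool fun u => (f.pos u).1) + g₁.rot.1.mulVec (Φ.tX f) =
      g₁.rot.1.mulVec (BITR.pool (fun u => (f.pos u).1) + Φ.tX f) + g₁.trans := by
    rw [BITR.SE3.act, Matrix.mulVec_add]
    abel
  have hmul (x : BITR.Vec3) : (g₂.rot * r * g₁.rot⁻¹).1.mulVec x =
      (g₂.rot * r).1.mulVec ((g₁.rot⁻¹).1.mulVec x) := (Matrix.mulVec_mulVec _ _ _).symm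
  have hmul' (x : BITR.Vec3) : (g₂.rot * r).1.mulVec x = g₂.rot.1.mulVec (r.1.mulVec x) :=
    (Matrix.mulVec_mulVec _ _ _).symm
  rw [hact, hmul, Matrix.mulVec_add, hinv, hmul', hmul', BITR.SE3.act]
  simp only [Matrix.mulVec_add, Matrix.mulVec_sub, Matrix.mulVec_neg]
  abel
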